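/- **Theorem 2.1.** Let $k_i,c_i>0$ ($i=1,2,3$), $\rho,\ell_1,\ell_2,h_0>0$ and $A_\infty>B>C>D$ be real numbers, put $\alpha_i=\frac{k_i}{\rho c_i}$, $\delta_i=\rho\ell_i$, $\mathrm{Ste}_1=\frac{c_1(C-D)}{\ell_1}$, $\mathrm{Ste}_2=\frac{c_2(B-C)}{\ell_2}$, and assume $\alpha_2>\alpha_3$. Consider the three-phase Stefan problem of finding temperatures $\Phi_1,\Phi_2,\Phi_3$ and interfaces $y_1,y_2$ with $0<y_2(t)<y_1(t)$ for $t>0$, such that $$\partial_t\Phi_3=\alpha_3\partial_{xx}\Phi_3\ (0<x<y_2(t)),\quad \partial_t\Phi_2=\alpha_2\partial_{xx}\Phi_2\ (y_2(t)<x<y_1(t)),\quad \partial_t\Phi_1=\alpha_1\partial_{xx}\Phi_1\ (x>y_1(t)),$$ $$\Phi_3(y_2(t),t)=\Phi_2(y_2(t),t)=B,\qquad \Phi_2(y_1(t),t)=\Phi_1(y_1(t),t)=C,\qquad \Phi_1(x,0)=\Phi_1(+\infty,t)=D,$$ $$k_2\,\partial_x\Phi_2(y_2(t),t)-k_3\,\partial_x\Phi_3(y_2(t),t)=\delta_2\,\dot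 y_2(t),\qquad k_1\,\partial_x\Phi_1(y_1(t),t)-k_2\,\partial_x\Phi_2(y_1(t),t)=\delta_1\,\dot y_1(t),$$ $$y_1(0)=y_2(0)=0,\qquad k_3\,\partial_x\Phi_3(0,t)=\frac{h_0}{\sqrt t}\,\bigl(\Phi_3(0,t)-A_\infty\bigr)$$ for all $t>0$, in the classical sense: the temperatures are continuous up to the boundary of their phases for $t>0$, the derivatives at $x=0$ and at the interfaces are one-sided, $y_1,y_2$ are continuous on $[0,\infty)$ and differentiable on $(0,\infty)$, and the initial condition is attained as a limit at every $x>0$. A solution is of similarity type if in each phase the temperature is a function of $x/\sqrt t$ only. Let $$\varphi(z)=z+\frac{\mathrm{Ste}_1}{\sqrt\pi}\frac{e^{-z^2}}{\operatorname{erfc}(z)},\qquad H(z)=\operatorname{erf}\Bigl(z\sqrt{\tfrac{\alpha_1}{\alpha_2}}\Bigr)-\frac{\mathrm{Ste}_2}{\sqrt\pi}\frac{\ell_2}{\ell_1}\sqrt{\frac{k_2c_1}{k_1c_2}}\,\frac{e^{-z^2\alpha_1/\alpha_2}}{\varphi(z)},\qquad Q(z)=\frac{\ell_1}{\ell_2}\varphi(z)\,e^{z^2\alpha_1/\alpha_2},$$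 $$T(z)=\frac{\mathrm{Ste}_2}{\sqrt\pi\,c_2}\,\frac{A_\infty-B}{B-C}\sqrt{\frac{k_3c_1c_3}{k_1}}\;\frac{\exp\bigl(-z^2\alpha_1(\frac1{\alpha_3}-\frac1{\alpha_2})\bigr)}{\frac{k_3}{h_0\sqrt{\pi\alpha_3}}+\operatorname{erf}\bigl(z\sqrt{\alpha_1/\alpha_3}\bigr)}-z\,e^{z^2\alpha_1/\alpha_2},\qquad U(z)=T\Bigl(\sqrt{\tfrac{\alpha_2}{\alpha_1}}\,\operatorname{erf}^{-1}(H(z))\Bigr).$$ Then $H$ has exactly one zero $z_0$ in $[0,\infty)$, and $z_0>0$. If moreover $$h_0>h_2:=\frac{B-C}{A_\infty-B}\sqrt{\frac{k_2k_3c_2}{\pi c_3\alpha_3}}\;\frac1{\operatorname{erf}\bigl(z_0\sqrt{\alpha_1/\alpha_2}\bigr)},$$ then the equation $Q(z)=U(z)$ has exactly one root $\xi_1$ in $(z_0,\infty)$; the number $\xi_2=\sqrt{\alpha_2/\alpha_1}\,\operatorname{erf}^{-1}(H(\xi_1))$ is well defined and satisfies $\operatorname{erf}(\xi_2\sqrt{\alpha_1/\alpha_2})=H(\xi_1)$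 and $0<\xi_2<\xi_1$; and the problem has a unique solution of similarity type, namely $$v_3(x,t)=\frac{\frac{Bk_3}{h_0\sqrt{\pi\alpha_3}}+A_\infty\operatorname{erf}\bigl(\xi_2\sqrt{\frac{\alpha_1}{\alpha_3}}\bigr)-(A_\infty-B)\operatorname{erf}\bigl(\frac{x}{2\sqrt{\alpha_3t}}\bigr)}{\frac{k_3}{h_0\sqrt{\pi\alpha_3}}+\operatorname{erf}\bigl(\xi_2\sqrt{\frac{\alpha_1}{\alpha_3}}\bigr)},$$ $$v_2(x,t)=\frac{-C\operatorname{erf}\bigl(\xi_2\sqrt{\frac{\alpha_1}{\alpha_2}}\bigr)+B\operatorname{erf}\bigl(\xi_1\sqrt{\frac{\alpha_1}{\alpha_2}}\bigr)-(B-C)\operatorname{erf}\bigl(\frac{x}{2\sqrt{\alpha_2t}}\bigr)}{\operatorname{erf}\bigl(\xi_1\sqrt{\frac{\alpha_1}{\alpha_2}}\bigr)-\operatorname{erf}\bigl(\xi_2\sqrt{\frac{\alpha_1}{\alpha_2}}\bigr)},$$ $$v_1(x,t)=\frac{C\bigl(1-\operatorname{erf}\bigl(\frac{x}{2\sqrt{\alpha_1t}}\bigr)\bigr)+D\bigl(\operatorname{erf}\bigl(\frac{x}{2\sqrt{\alpha_1t}}\bigr)-\operatorname{erf}(\xi_1)\bigr)}{\operatorname{erfc}(\xi_1)},$$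 in the respective phases $0<x<w_2(t)$, $w_2(t)<x<w_1(t)$, $x>w_1(t)$, with interfaces $w_2(t)=2\xi_2\sqrt{\alpha_1t}$ and $w_1(t)=2\xi_1\sqrt{\alpha_1t}$. -/

import Mathlib

open Real Set Filter Topology

namespace ThreePhaseStefan

noncomputable section

/-- The error function `erf x = (2 / √π) ∫₀ˣ exp (-u²) du`. -/
def erf (x : ℝ) : ℝ := 2 / √π * ∫ u in (0 : ℝ)..x, Real.exp (-u ^ 2)

/-- The complementary error function. -/
def erfc (x : ℝ) : ℝ := 1 - erf x

/-- The inverse of the error function. It is the true inverse on the range `(-1, 1)` of `erf`,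
which is the only place where it is used. -/
def erfInv : ℝ → ℝ := Function.invFun erf

/-- The data of the problem: conductivities `kᵢ`, specific heats `cᵢ`, mass density `ρ`, latent
heats per unit mass `ℓᵢ`, heat transfer coefficient `h₀`, bulk temperature `Ainf`, phase change
temperatures `B`, `C` and initial temperature `D`. -/
structure Params where
  (k₁ k₂ k₃ : ℝ)
  (c₁ c₂ c₃ : ℝ)
  (ρ : ℝ)
  (ℓ₁ ℓ₂ : ℝ)
  (h₀ : ℝ)
  (Ainf B C D : ℝ)

/-- The physical standing assumptions on the data. -/
structure Params.Admissible (p : Params) : Prop where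
  k₁_pos : 0 < p.k₁
  k₂_pos : 0 < p.k₂
  k₃_pos : 0 < p.k₃
  c₁_pos : 0 < p.c₁
  c₂_pos : 0 < p.c₂
  c₃_pos : 0 < p.c₃
  ρ_pos : 0 < p.ρ
  ℓ₁_pos : 0 < p.ℓ₁
  ℓ₂_pos : 0 < p.ℓ₂
  h₀_pos : 0 < p.h₀
  B_lt_Ainf : p.B < p.Ainf
  C_lt_B : p.C < p.B
  D_lt_C : p.D < p.C

namespace Params

variable (p : Params)

/-- Thermal diffusivities. -/
def α₁ : ℝ := p.k₁ / (p.ρ * p.c₁)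
def α₂ : ℝ := p.k₂ / (p.ρ * p.c₂)
def α₃ : ℝ := p.k₃ / (p.ρ * p.c₃)

/-- Latent heats per unit volume. -/
def δ₁ : ℝ := p.ρ * p.ℓ₁
def δ₂ : ℝ := p.ρ * p.ℓ₂

/-- Stefan numbers. -/
def Ste₁ : ℝ := p.c₁ * (p.C - p.D) / p.ℓ₁
def Ste₂ : ℝ := p.c₂ * (p.B - p.C) / p.ℓ₂

def phi (z : ℝ) : ℝ := z + p.Ste₁ / √π * (Real.exp (-z ^ 2) / erfc z)

def H (z : ℝ) : ℝ :=
  erf (z * √(p.α₁ / p.α₂)) -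
    p.Ste₂ / √π * (p.ℓ₂ / p.ℓ₁) * √(p.k₂ * p.c₁ / (p.k₁ * p.c₂)) *
      (Real.exp (-z ^ 2 * (p.α₁ / p.α₂)) / p.phi z)

def Q (z : ℝ) : ℝ := p.ℓ₁ / p.ℓ₂ * p.phi z * Real.exp (z ^ 2 * (p.α₁ / p.α₂))

def T (z : ℝ) : ℝ :=
  p.Ste₂ / (√π * p.c₂) * ((p.Ainf - p.B) / (p.B - p.C)) * √(p.k₃ * p.c₁ * p.c₃ / p.k₁) *
      (Real.exp (-z ^ 2 * p.α₁ * (1 / p.α₃ - 1 / p.α₂)) /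
        (p.k₃ / (p.h₀ * √(π * p.α₃)) + erf (z * √(p.α₁ / p.α₃)))) -
    z * Real.exp (z ^ 2 * (p.α₁ / p.α₂))

/-- The value of `ξ₂` that corresponds to `ξ₁ = z`. -/
def xi₂ (z : ℝ) : ℝ := √(p.α₂ / p.α₁) * erfInv (p.H z)

def U (z : ℝ) : ℝ := p.T (p.xi₂ z)

/-- The threshold for the heat transfer coefficient, as a function of the zero `z₀` of `H`. -/
def h₂ (z₀ : ℝ) : ℝ :=
  (p.B - p.C) / (p.Ainf - p.B) * √(p.k₂ * p.k₃ * p.c₂ / (π * p.c₃ * p.α₃)) *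
    (1 / erf (z₀ * √(p.α₁ / p.α₂)))

end Params

/-- Three temperatures `Φᵢ x t` and two interfaces `yᵢ t`. Only the values of `Φ₃` on
`0 ≤ x ≤ y₂ t`, of `Φ₂` on `y₂ t ≤ x ≤ y₁ t`, of `Φ₁` on `y₁ t ≤ x` for `t > 0`, and of
`yᵢ` for `t ≥ 0`, are meaningful. -/
structure Candidate where
  (Φ₁ Φ₂ Φ₃ : ℝ → ℝ → ℝ)
  (y₁ y₂ : ℝ → ℝ)

/-- `Φ` has the derivatives `Φ_t`, `Φ_x`, `Φ_xx` at `(x, t)`, and `Φ_t = α Φ_xx` there. -/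
def HeatEqAt (α : ℝ) (Φ : ℝ → ℝ → ℝ) (x t : ℝ) : Prop :=
  DifferentiableAt ℝ (fun s => Φ x s) t ∧
  (∀ᶠ r in 𝓝 x, DifferentiableAt ℝ (fun r => Φ r t) r) ∧
  DifferentiableAt ℝ (deriv fun r => Φ r t) x ∧
  deriv (fun s => Φ x s) t = α * deriv (deriv fun r => Φ r t) x

/-- Classical solutions of the three-phase Stefan problem with the convective condition at
`x = 0`. The spatial derivatives on the interfaces and at `x = 0` are one-sided, taken from the
phase under consideration; the initial condition is taken as a limit from inside phase 1. -/
structure IsSolution (p : Params) (s : Candidate) : Prop where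
  -- the three phases are present for all positive times
  y₂_pos : ∀ t, 0 < t → 0 < s.y₂ t
  y₂_lt_y₁ : ∀ t, 0 < t → s.y₂ t < s.y₁ t
  -- regularity of the interfaces
  y₁_cont : ContinuousOn s.y₁ (Ici 0)
  y₂_cont : ContinuousOn s.y₂ (Ici 0)
  y₁_diff : ∀ t, 0 < t → DifferentiableAt ℝ s.y₁ t
  y₂_diff : ∀ t, 0 < t → DifferentiableAt ℝ s.y₂ t
  -- regularity of the temperatures up to the boundary of their phases
  Φ₃_cont : ContinuousOn (fun q : ℝ × ℝ => s.Φ₃ q.1 q.2)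
    {q | 0 < q.2 ∧ 0 ≤ q.1 ∧ q.1 ≤ s.y₂ q.2}
  Φ₂_cont : ContinuousOn (fun q : ℝ × ℝ => s.Φ₂ q.1 q.2)
    {q | 0 < q.2 ∧ s.y₂ q.2 ≤ q.1 ∧ q.1 ≤ s.y₁ q.2}
  Φ₁_cont : ContinuousOn (fun q : ℝ × ℝ => s.Φ₁ q.1 q.2)
    {q | 0 < q.2 ∧ s.y₁ q.2 ≤ q.1}
  Φ₃_diff : ∀ t, 0 < t → DifferentiableOn ℝ (fun x => s.Φ₃ x t) (Icc 0 (s.y₂ t))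
  Φ₂_diff : ∀ t, 0 < t → DifferentiableOn ℝ (fun x => s.Φ₂ x t) (Icc (s.y₂ t) (s.y₁ t))
  Φ₁_diff : ∀ t, 0 < t → DifferentiableOn ℝ (fun x => s.Φ₁ x t) (Ici (s.y₁ t))
  -- heat equations
  heat₃ : ∀ x t, 0 < t → 0 < x → x < s.y₂ t → HeatEqAt p.α₃ s.Φ₃ x t
  heat₂ : ∀ x t, 0 < t → s.y₂ t < x → x < s.y₁ t → HeatEqAt p.α₂ s.Φ₂ x t
  heat₁ : ∀ x t, 0 < t → s.y₁ t < x → HeatEqAt p.α₁ s.Φ₁ x t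
  -- phase change temperatures on the interfaces
  Φ₃_y₂ : ∀ t, 0 < t → s.Φ₃ (s.y₂ t) t = p.B
  Φ₂_y₂ : ∀ t, 0 < t → s.Φ₂ (s.y₂ t) t = p.B
  Φ₂_y₁ : ∀ t, 0 < t → s.Φ₂ (s.y₁ t) t = p.C
  Φ₁_y₁ : ∀ t, 0 < t → s.Φ₁ (s.y₁ t) t = p.C
  -- initial temperature, and temperature at infinity
  initial : ∀ x, 0 < x → Tendsto (fun q : ℝ × ℝ => s.Φ₁ q.1 q.2)
    (𝓝[{q | 0 < q.2 ∧ s.y₁ q.2 < q.1}] (x, 0)) (𝓝 p.D)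
  infinity : ∀ t, 0 < t → Tendsto (fun x => s.Φ₁ x t) atTop (𝓝 p.D)
  -- Stefan conditions
  stefan₂ : ∀ t, 0 < t →
    p.k₂ * derivWithin (fun x => s.Φ₂ x t) (Icc (s.y₂ t) (s.y₁ t)) (s.y₂ t) -
      p.k₃ * derivWithin (fun x => s.Φ₃ x t) (Icc 0 (s.y₂ t)) (s.y₂ t) = p.δ₂ * deriv s.y₂ t
  stefan₁ : ∀ t, 0 < t →
    p.k₁ * derivWithin (fun x => s.Φ₁ x t) (Ici (s.y₁ t)) (s.y₁ t) -
      p.k₂ * derivWithin (fun x => s.Φ₂ x t) (Icc (s.y₂ t) (s.y₁ t)) (s.y₁ t) =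
        p.δ₁ * deriv s.y₁ t
  -- initial position of the interfaces
  y₁_zero : s.y₁ 0 = 0
  y₂_zero : s.y₂ 0 = 0
  -- convective condition at the fixed face
  robin : ∀ t, 0 < t →
    p.k₃ * derivWithin (fun x => s.Φ₃ x t) (Icc 0 (s.y₂ t)) 0 =
      p.h₀ / √t * (s.Φ₃ 0 t - p.Ainf)

/-- Similarity type: in each phase the temperature is a function of `x / √t` only. The profiles
are arbitrary functions, and nothing is prescribed about the interfaces. -/
def IsSimilarityType (s : Candidate) : Prop :=
  ∃ f₁ f₂ f₃ : ℝ → ℝ, ∀ t, 0 < t →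
    (∀ x ∈ Icc 0 (s.y₂ t), s.Φ₃ x t = f₃ (x / √t)) ∧
    (∀ x ∈ Icc (s.y₂ t) (s.y₁ t), s.Φ₂ x t = f₂ (x / √t)) ∧
    (∀ x ∈ Ici (s.y₁ t), s.Φ₁ x t = f₁ (x / √t))

/-- The same interfaces, and the same temperatures in each phase. -/
def Same (s s' : Candidate) : Prop :=
  (∀ t, 0 ≤ t → s.y₁ t = s'.y₁ t ∧ s.y₂ t = s'.y₂ t) ∧
  ∀ t, 0 < t →
    (∀ x ∈ Icc 0 (s'.y₂ t), s.Φ₃ x t = s'.Φ₃ x t) ∧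
    (∀ x ∈ Icc (s'.y₂ t) (s'.y₁ t), s.Φ₂ x t = s'.Φ₂ x t) ∧
    (∀ x ∈ Ici (s'.y₁ t), s.Φ₁ x t = s'.Φ₁ x t)

/-- The explicit temperatures and interfaces with parameters `ξ₁`, `ξ₂`. -/
def explicit (p : Params) (ξ₁ ξ₂ : ℝ) : Candidate where
  Φ₃ x t :=
    (p.B * p.k₃ / (p.h₀ * √(π * p.α₃)) + p.Ainf * erf (ξ₂ * √(p.α₁ / p.α₃)) -
        (p.Ainf - p.B) * erf (x / (2 * √(p.α₃ * t)))) /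
      (p.k₃ / (p.h₀ * √(π * p.α₃)) + erf (ξ₂ * √(p.α₁ / p.α₃)))
  Φ₂ x t :=
    (-p.C * erf (ξ₂ * √(p.α₁ / p.α₂)) + p.B * erf (ξ₁ * √(p.α₁ / p.α₂)) -
        (p.B - p.C) * erf (x / (2 * √(p.α₂ * t)))) /
      (erf (ξ₁ * √(p.α₁ / p.α₂)) - erf (ξ₂ * √(p.α₁ / p.α₂)))
  Φ₁ x t :=
    (p.C * (1 - erf (x / (2 * √(p.α₁ * t)))) +
        p.D * (erf (x / (2 * √(p.α₁ * t))) - erf ξ₁)) / erfc ξ₁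
  y₂ t := 2 * ξ₂ * √(p.α₁ * t)
  y₁ t := 2 * ξ₁ * √(p.α₁ * t)

end

end ThreePhaseStefan

namespace ThreePhaseStefan

/-! For any `0 < ξ₂ < ξ₁` the explicit candidate satisfies every condition of the problem except
possibly the two Stefan conditions. There all terms scale as `1/√t`, so time drops out. The outer
condition becomes `H ξ₁ = erf (ξ₂ √(α₁/α₂))`, and modulo that equation the inner one becomes `Q ξ₁ =
T ξ₂` (`explicit_stefan₁_iff`, `explicit_stefan₂_iff`).

The first equation determines `ξ₂ = xi₂ ξ₁`, and `ξ₂ > 0` forces `ξ₁ > z₀`. What remains is `Q = U`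
on `(z₀, ∞)`. There `Q` increases to infinity, because `phi` is increasing by the Mills ratio bound,
while `U = T ∘ xi₂` decreases, because `α₃ < α₂`. The condition `h₀ > h₂` says exactly that `Q < U`
at `z₀`, so there is one crossing (`exists_unique_root`).

For uniqueness, similarity turns the heat equation at a fixed time into a linear ODE whose solutions
are `c + K erf` (`exists_heatProfile_of_similarity`). Injectivity of these profiles forces both
interfaces to be multiples of `√t`. The boundary data then fix `c` and `K`, so the solution is an
explicit candidate (`exists_same_explicit`) and the scalar equations identify its parameters. -/

/-! ### The error function, its inverse and the Mills ratio. -/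

lemma hasDerivAt_erf (x : ℝ) : HasDerivAt erf (2 / √π * Real.exp (-x ^ 2)) x := by
  have hc : Continuous fun u : ℝ => Real.exp (-u ^ 2) := by fun_prop
  exact (hc.integral_hasStrictDerivAt 0 x).hasDerivAt.const_mul _

lemma continuous_erf : Continuous erf :=
  continuous_iff_continuousAt.2 fun x => (hasDerivAt_erf x).continuousAt

lemma erf_strictMono : StrictMono erf :=
  strictMono_of_deriv_pos fun x => by
    rw [(hasDerivAt_erf x).deriv]
    positivity

@[simp] lemma erf_zero : erf 0 = 0 := by simp [erf]

lemma erf_neg (x : ℝ) : erf (-x) = -erf x := by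
  have h := intervalIntegral.integral_comp_neg (a := 0) (b := x)
    (f := fun u : ℝ => Real.exp (-u ^ 2))
  simp only [even_two.neg_pow, neg_zero] at h
  unfold erf
  rw [h, intervalIntegral.integral_symm (-x) 0]
  ring

lemma erf_pos {x : ℝ} (hx : 0 < x) : 0 < erf x := erf_zero ▸ erf_strictMono hx

lemma erf_nonneg {x : ℝ} (hx : 0 ≤ x) : 0 ≤ erf x := erf_zero ▸ erf_strictMono.monotone hx

lemma tendsto_erf_atTop : Tendsto erf atTop (𝓝 1) := by
  have hi : MeasureTheory.IntegrableOn (fun u : ℝ => Real.exp (-u ^ 2)) (Ioi 0) := by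
    simpa using (integrable_exp_neg_mul_sq one_pos).integrableOn
  have h := (MeasureTheory.intervalIntegral_tendsto_integral_Ioi 0 hi tendsto_id).const_mul
    (2 / √π)
  have hg := integral_gaussian_Ioi 1
  simp only [neg_mul, one_mul, div_one] at hg
  rw [hg] at h
  have h1 : 2 / √π * (√π / 2) = 1 := by
    have : √π ≠ 0 := by positivity
    field_simp
  rw [h1] at h
  exact h

lemma erf_lt_one (x : ℝ) : erf x < 1 :=
  (erf_strictMono (lt_add_one x)).trans_le
    (erf_strictMono.monotone.ge_of_tendsto tendsto_erf_atTop _)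

lemma erfc_pos (x : ℝ) : 0 < erfc x := sub_pos.2 (erf_lt_one x)

lemma exists_erf_eq {y : ℝ} (h₀ : -1 < y) (h₁ : y < 1) : ∃ x, erf x = y := by
  obtain ⟨u, hu⟩ := ((tendsto_order.1 tendsto_erf_atTop).1 _ h₁).exists
  obtain ⟨v, hv⟩ := ((tendsto_order.1 tendsto_erf_atTop).1 (-y) (by linarith)).exists
  exact mem_range_of_exists_le_of_exists_ge continuous_erf
    ⟨-v, by rw [erf_neg]; linarith⟩ ⟨u, hu.le⟩

lemma erfInv_erf (x : ℝ) : erfInv (erf x) = x :=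
  Function.leftInverse_invFun erf_strictMono.injective x

lemma erf_erfInv {y : ℝ} (h₀ : -1 < y) (h₁ : y < 1) : erf (erfInv y) = y := by
  obtain ⟨x, rfl⟩ := exists_erf_eq h₀ h₁
  rw [erfInv_erf]

lemma strictMonoOn_erfInv : StrictMonoOn erfInv (Ioo (-1) 1) := by
  intro x hx y hy hxy
  rwa [← erf_strictMono.lt_iff_lt, erf_erfInv hx.1 hx.2, erf_erfInv hy.1 hy.2]

lemma neg_one_lt_erf (x : ℝ) : -1 < erf x := by
  have := erf_lt_one (-x)
  rw [erf_neg] at this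
  linarith

/-- A strictly monotone map whose image is a neighbourhood of the value is continuous; here `(-1,
1)` is mapped onto all of `ℝ`. -/
lemma continuousAt_erfInv {y : ℝ} (h₀ : -1 < y) (h₁ : y < 1) : ContinuousAt erfInv y := by
  refine strictMonoOn_erfInv.continuousAt_of_image_mem_nhds (Ioo_mem_nhds h₀ h₁) ?_
  convert univ_mem
  exact eq_univ_of_forall fun x => ⟨erf x, ⟨neg_one_lt_erf x, erf_lt_one x⟩, erfInv_erf x⟩

lemma hasDerivAt_exp_neg_sq (x : ℝ) :
    HasDerivAt (fun z : ℝ => Real.exp (-z ^ 2)) (-(2 * x) * Real.exp (-x ^ 2)) x := by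
  refine (hasDerivAt_pow 2 x).fun_neg.exp.congr_deriv ?_
  simp
  ring

lemma tendsto_exp_neg_sq : Tendsto (fun z : ℝ => Real.exp (-z ^ 2)) atTop (𝓝 0) :=
  Real.tendsto_exp_atBot.comp (tendsto_neg_atTop_atBot.comp (tendsto_pow_atTop two_ne_zero))

/-- The Mills ratio bound for the complementary error function. -/
lemma mul_erfc_le {z : ℝ} (hz : 0 ≤ z) : z * erfc z ≤ Real.exp (-z ^ 2) / √π := by
  rcases hz.eq_or_lt with rfl | hz
  · simp
  have hπ : 0 < √π := by positivity
  -- The bound divided by `z`: `k` is decreasing with limit 0 at infinity, hence nonnegative.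
  set k : ℝ → ℝ := fun z => Real.exp (-z ^ 2) / √π / z - erfc z with hk
  have hd : ∀ x, 0 < x → HasDerivAt k (-(Real.exp (-x ^ 2) / (√π * x ^ 2))) x := by
    intro x hx
    have h := (((hasDerivAt_exp_neg_sq x).div_const √π).fun_div (hasDerivAt_id x) hx.ne').sub
      ((hasDerivAt_erf x).const_sub 1)
    refine h.congr_deriv ?_
    simp only [id]
    field_simp
    ring
  have hanti : AntitoneOn k (Ioi 0) := by
    refine antitoneOn_of_deriv_nonpos (convex_Ioi 0)
      (fun x hx => (hd x hx).continuousAt.continuousWithinAt)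
      (fun x hx => (hd x (by simpa using hx)).differentiableAt.differentiableWithinAt) ?_
    intro x hx
    rw [interior_Ioi] at hx
    rw [(hd x hx).deriv, neg_nonpos]
    positivity
  have hlim : Tendsto k atTop (𝓝 0) := by
    have h1 := (tendsto_exp_neg_sq.div_const √π).div_atTop tendsto_id
    have h2 := h1.sub (tendsto_erf_atTop.const_sub 1)
    simpa [hk, erfc] using h2
  have h0 : 0 ≤ k z := ge_of_tendsto' (f := fun n : ℝ => k z) (x := atTop) tendsto_const_nhds
    (fun _ => le_of_tendsto hlim
      ((eventually_ge_atTop z).mono fun y hy => hanti hz (hz.trans_le hy) hy))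
  have h1 : erfc z ≤ Real.exp (-z ^ 2) / √π / z := sub_nonneg.1 h0
  rw [le_div_iff₀ hz] at h1
  linarith

/-- The sign of the derivative is that of `exp (-x²)/√π - x erfc x`, which is the Mills ratio bound.
The monotonicity of `phi`, and through it that of `H` and `Q`, rests on this. -/
lemma monotoneOn_exp_div_erfc :
    MonotoneOn (fun z => Real.exp (-z ^ 2) / erfc z) (Ici 0) := by
  have hd : ∀ x, HasDerivAt (fun z => Real.exp (-z ^ 2) / erfc z)
      (2 * Real.exp (-x ^ 2) * (Real.exp (-x ^ 2) / √π - x * erfc x) / erfc x ^ 2) x := by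
    intro x
    refine ((hasDerivAt_exp_neg_sq x).fun_div ((hasDerivAt_erf x).const_sub 1)
      (erfc_pos x).ne').congr_deriv ?_
    simp only [erfc]
    ring
  refine monotoneOn_of_deriv_nonneg (convex_Ici 0)
    (fun x _ => (hd x).continuousAt.continuousWithinAt)
    (fun x _ => (hd x).differentiableAt.differentiableWithinAt) ?_
  intro x hx
  rw [interior_Ici] at hx
  have := mul_erfc_le hx.le
  rw [(hd x).deriv]
  have : 0 ≤ Real.exp (-x ^ 2) / √π - x * erfc x := by linarith
  positivity

lemma continuous_erfc : Continuous erfc := continuous_const.sub continuous_erf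

lemma exists_unique_zero_of_strictMonoOn {f : ℝ → ℝ} {a : ℝ} (hc : ContinuousOn f (Ici a))
    (hm : StrictMonoOn f (Ici a)) (ha : f a < 0) (hpos : ∃ b, a ≤ b ∧ 0 ≤ f b) :
    ∃ z, a < z ∧ f z = 0 ∧ ∀ y, a ≤ y → f y = 0 → y = z := by
  obtain ⟨b, hab, hb⟩ := hpos
  obtain ⟨z, hz, hfz⟩ := intermediate_value_Icc hab (hc.mono Icc_subset_Ici_self) ⟨ha.le, hb⟩
  refine ⟨z, hz.1.lt_of_ne ?_, hfz, fun y hy hfy => hm.injOn hy hz.1 (hfy.trans hfz.symm)⟩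
  rintro rfl
  exact ha.ne hfz

/-! ### Monotonicity and limits of `phi`, `H`, `Q` and `T`. -/

namespace Params

variable {p : Params}

namespace Admissible

variable (hp : p.Admissible)
include hp

lemma α₁_pos : 0 < p.α₁ := div_pos hp.k₁_pos (mul_pos hp.ρ_pos hp.c₁_pos)
lemma α₂_pos : 0 < p.α₂ := div_pos hp.k₂_pos (mul_pos hp.ρ_pos hp.c₂_pos)
lemma α₃_pos : 0 < p.α₃ := div_pos hp.k₃_pos (mul_pos hp.ρ_pos hp.c₃_pos)

lemma Ste₁_pos : 0 < p.Ste₁ :=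
  div_pos (mul_pos hp.c₁_pos (sub_pos.2 hp.D_lt_C)) hp.ℓ₁_pos

lemma Ste₂_pos : 0 < p.Ste₂ :=
  div_pos (mul_pos hp.c₂_pos (sub_pos.2 hp.C_lt_B)) hp.ℓ₂_pos

lemma phi_strictMonoOn : StrictMonoOn p.phi (Ici 0) := by
  intro x hx y hy hxy
  have := hp.Ste₁_pos
  have h := monotoneOn_exp_div_erfc hx hy hxy.le
  have : p.Ste₁ / √π * (Real.exp (-x ^ 2) / erfc x) ≤
    p.Ste₁ / √π * (Real.exp (-y ^ 2) / erfc y) := mul_le_mul_of_nonneg_left h (by positivity)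
  simp only [phi]
  linarith

lemma lt_phi (z : ℝ) : z < p.phi z := by
  have := hp.Ste₁_pos
  have := erfc_pos z
  simp only [phi, lt_add_iff_pos_right]
  positivity

lemma phi_pos {z : ℝ} (hz : 0 ≤ z) : 0 < p.phi z := hz.trans_lt (hp.lt_phi z)

omit hp in
lemma phi_continuous : Continuous p.phi := by
  have := continuous_erfc
  unfold phi
  exact continuous_id.add (continuous_const.mul
    ((by fun_prop : Continuous fun z : ℝ => Real.exp (-z ^ 2)).div this fun z => (erfc_pos z).ne'))

lemma exp_div_phi_strictAntiOn :
    StrictAntiOn (fun z => Real.exp (-z ^ 2 * (p.α₁ / p.α₂)) / p.phi z) (Ici 0) := by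
  intro x hx y hy hxy
  have h1 := hp.phi_strictMonoOn hx hy hxy
  have h2 := hp.phi_pos hx
  have ha := div_pos hp.α₁_pos hp.α₂_pos
  have hsq : x ^ 2 ≤ y ^ 2 := pow_le_pow_left₀ hx hxy.le 2
  have h3 : Real.exp (-y ^ 2 * (p.α₁ / p.α₂)) ≤ Real.exp (-x ^ 2 * (p.α₁ / p.α₂)) :=
    Real.exp_le_exp.2 (mul_le_mul_of_nonneg_right (neg_le_neg hsq) ha.le)
  exact div_lt_div₀' h3 h1 (Real.exp_pos _) h2

lemma H_coeff_pos :
    0 < p.Ste₂ / √π * (p.ℓ₂ / p.ℓ₁) * √(p.k₂ * p.c₁ / (p.k₁ * p.c₂)) := by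
  have := hp.Ste₂_pos
  have := hp.ℓ₁_pos
  have := hp.ℓ₂_pos
  have := hp.k₁_pos
  have := hp.k₂_pos
  have := hp.c₁_pos
  have := hp.c₂_pos
  positivity

lemma sqrt_ratio_pos : 0 < √(p.α₁ / p.α₂) := sqrt_pos.2 (div_pos hp.α₁_pos hp.α₂_pos)

lemma H_strictMonoOn : StrictMonoOn p.H (Ici 0) := by
  intro x hx y hy hxy
  have h1 := mul_lt_mul_of_pos_left (hp.exp_div_phi_strictAntiOn hx hy hxy) hp.H_coeff_pos
  have h2 := erf_strictMono (mul_lt_mul_of_pos_right hxy hp.sqrt_ratio_pos)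
  simp only [H]
  linarith

/-- At `z = 0` this makes `H` start negative; at a root `ξ₁` it is the inequality `ξ₂ < ξ₁`. -/
lemma H_lt_erf {z : ℝ} (hz : 0 ≤ z) : p.H z < erf (z * √(p.α₁ / p.α₂)) := by
  have := hp.H_coeff_pos
  have := hp.phi_pos hz
  simp only [H, sub_lt_self_iff]
  positivity

lemma H_lt_one {z : ℝ} (hz : 0 ≤ z) : p.H z < 1 := (hp.H_lt_erf hz).trans (erf_lt_one _)

lemma H_continuousOn : ContinuousOn p.H (Ici 0) := by
  have h1 := continuous_erf
  have h2 := phi_continuous (p := p)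
  unfold H
  refine (h1.comp (continuous_mul_const _)).continuousOn.sub (continuousOn_const.mul ?_)
  exact (by fun_prop : Continuous fun z : ℝ => Real.exp (-z ^ 2 * (p.α₁ / p.α₂))).continuousOn.div
    h2.continuousOn fun z hz => (hp.phi_pos hz).ne'

lemma tendsto_phi : Tendsto p.phi atTop atTop :=
  tendsto_atTop_mono (fun z => (hp.lt_phi z).le) tendsto_id

lemma tendsto_H : Tendsto p.H atTop (𝓝 1) := by
  have h1 : Tendsto (fun z => erf (z * √(p.α₁ / p.α₂))) atTop (𝓝 1) :=
    tendsto_erf_atTop.comp (tendsto_id.atTop_mul_const hp.sqrt_ratio_pos)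
  have h2 : Tendsto (fun z : ℝ => Real.exp (-z ^ 2 * (p.α₁ / p.α₂))) atTop (𝓝 0) :=
    Real.tendsto_exp_atBot.comp ((tendsto_neg_atTop_atBot.comp
      (tendsto_pow_atTop two_ne_zero)).atBot_mul_const (div_pos hp.α₁_pos hp.α₂_pos))
  have h3 := h1.sub ((h2.div_atTop hp.tendsto_phi).const_mul
    (p.Ste₂ / √π * (p.ℓ₂ / p.ℓ₁) * √(p.k₂ * p.c₁ / (p.k₁ * p.c₂))))
  rwa [mul_zero, sub_zero] at h3

/-- `H` has exactly one zero in `[0, ∞)`. -/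
lemma exists_unique_zero_H :
    ∃ z₀, 0 < z₀ ∧ p.H z₀ = 0 ∧ ∀ z, 0 ≤ z → p.H z = 0 → z = z₀ := by
  refine exists_unique_zero_of_strictMonoOn hp.H_continuousOn hp.H_strictMonoOn ?_ ?_
  · simpa using hp.H_lt_erf le_rfl
  · obtain ⟨b, hb, hb'⟩ := ((eventually_ge_atTop 0).and
      ((tendsto_order.1 hp.tendsto_H).1 0 one_pos)).exists
    exact ⟨b, hb, hb'.le⟩

lemma Q_strictMonoOn : StrictMonoOn p.Q (Ici 0) := by
  intro x hx y hy hxy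
  have h1 := hp.phi_strictMonoOn hx hy hxy
  have h2 := hp.phi_pos hx
  have h3 := hp.ℓ₁_pos
  have h4 := hp.ℓ₂_pos
  have ha := div_pos hp.α₁_pos hp.α₂_pos
  have hx' : 0 ≤ x := hx
  simp only [Q]
  gcongr

omit hp in
lemma Q_continuous : Continuous p.Q := by
  have := phi_continuous (p := p)
  unfold Q
  fun_prop

lemma tendsto_Q : Tendsto p.Q atTop atTop := by
  have h3 := hp.ℓ₁_pos
  have h4 := hp.ℓ₂_pos
  have ha := div_pos hp.α₁_pos hp.α₂_pos
  refine tendsto_atTop_mono' _ ?_ (hp.tendsto_phi.const_mul_atTop (div_pos h3 h4))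
  filter_upwards [eventually_ge_atTop 0] with z hz
  have h2 := hp.phi_pos hz
  exact le_mul_of_one_le_right (by positivity) (Real.one_le_exp (by positivity))

lemma robin_coeff_pos : 0 < p.k₃ / (p.h₀ * √(π * p.α₃)) := by
  have := hp.k₃_pos
  have := hp.h₀_pos
  have := hp.α₃_pos
  positivity

lemma T_coeff_pos :
    0 < p.Ste₂ / (√π * p.c₂) * ((p.Ainf - p.B) / (p.B - p.C)) *
      √(p.k₃ * p.c₁ * p.c₃ / p.k₁) := by
  have := hp.Ste₂_pos
  have := sub_pos.2 hp.B_lt_Ainf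
  have := sub_pos.2 hp.C_lt_B
  have := hp.k₁_pos
  have := hp.k₃_pos
  have := hp.c₁_pos
  have := hp.c₂_pos
  have := hp.c₃_pos
  positivity

/-- As `α₃ < α₂`, the exponent is nonincreasing in `z`, so the quotient is too. Strictness comes
from the subtracted term `z exp (z² α₁/α₂)` alone. -/
lemma T_strictAntiOn (hα : p.α₃ < p.α₂) : StrictAntiOn p.T (Ici 0) := by
  intro x hx y hy hxy
  have hx' : 0 ≤ x := hx
  have hy' : 0 ≤ y := hy
  have h1 := hp.T_coeff_pos
  have h2 := hp.robin_coeff_pos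
  have h3 := hp.α₁_pos
  have h4 : 0 ≤ 1 / p.α₃ - 1 / p.α₂ :=
    sub_nonneg.2 (one_div_le_one_div_of_le hp.α₃_pos hα.le)
  have ha := div_pos hp.α₁_pos hp.α₂_pos
  have h5 : 0 ≤ erf (x * √(p.α₁ / p.α₃)) := erf_nonneg (by positivity)
  have h6 : erf (x * √(p.α₁ / p.α₃)) ≤ erf (y * √(p.α₁ / p.α₃)) :=
    erf_strictMono.monotone (by gcongr)
  have h7 : x * Real.exp (x ^ 2 * (p.α₁ / p.α₂)) < y * Real.exp (y ^ 2 * (p.α₁ / p.α₂)) :=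
    mul_lt_mul'' hxy (by gcongr) hx' (Real.exp_pos _).le |>.trans_le le_rfl
  have h8 : Real.exp (-y ^ 2 * p.α₁ * (1 / p.α₃ - 1 / p.α₂)) /
        (p.k₃ / (p.h₀ * √(π * p.α₃)) + erf (y * √(p.α₁ / p.α₃))) ≤
      Real.exp (-x ^ 2 * p.α₁ * (1 / p.α₃ - 1 / p.α₂)) /
        (p.k₃ / (p.h₀ * √(π * p.α₃)) + erf (x * √(p.α₁ / p.α₃))) := by
    gcongr
  have := mul_le_mul_of_nonneg_left h8 h1.le
  simp only [T]
  linarith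

lemma T_continuousOn : ContinuousOn p.T (Ici 0) := by
  have h1 := continuous_erf
  unfold T
  refine (continuousOn_const.mul ?_).sub (by fun_prop)
  refine ContinuousOn.div (by fun_prop) (by fun_prop) fun z hz => ?_
  have hz' : 0 ≤ z := hz
  have h5 : 0 ≤ erf (z * √(p.α₁ / p.α₃)) := erf_nonneg (by positivity)
  have := hp.robin_coeff_pos
  positivity

lemma sqrt_ratio_inv_pos : 0 < √(p.α₂ / p.α₁) := sqrt_pos.2 (div_pos hp.α₂_pos hp.α₁_pos)

lemma sqrt_ratio_mul_inv : √(p.α₂ / p.α₁) * √(p.α₁ / p.α₂) = 1 := by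
  have h1 := hp.α₁_pos
  have h2 := hp.α₂_pos
  rw [← sqrt_mul (by positivity), div_mul_div_cancel₀ h1.ne', div_self h2.ne', sqrt_one]

lemma xi₂_mul_sqrt (z : ℝ) : p.xi₂ z * √(p.α₁ / p.α₂) = erfInv (p.H z) := by
  rw [xi₂, mul_right_comm, hp.sqrt_ratio_mul_inv, one_mul]

lemma erf_xi₂ {z : ℝ} (hz : 0 ≤ z) (h : 0 ≤ p.H z) :
    erf (p.xi₂ z * √(p.α₁ / p.α₂)) = p.H z := by
  rw [hp.xi₂_mul_sqrt, erf_erfInv (by linarith) (hp.H_lt_one hz)]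

/-- The outer Stefan condition leaves no freedom for `ξ₂` once `ξ₁` is known. -/
lemma eq_xi₂ {z y : ℝ} (h : p.H z = erf (y * √(p.α₁ / p.α₂))) : y = p.xi₂ z := by
  rw [xi₂, h, erfInv_erf, mul_comm, mul_assoc, mul_comm √_ √_, hp.sqrt_ratio_mul_inv, mul_one]

omit hp in
lemma xi₂_of_H_eq_zero {z : ℝ} (h : p.H z = 0) : p.xi₂ z = 0 := by
  have : erfInv 0 = 0 := by simpa using erfInv_erf 0
  rw [xi₂, h, this, mul_zero]

/-- Writing each conductivity through `√αᵢ` turns identities between square roots into rational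
identities in the atoms `√αᵢ`. -/
lemma k₁_eq : p.k₁ = p.ρ * p.c₁ * √p.α₁ ^ 2 := by
  rw [sq_sqrt hp.α₁_pos.le, α₁, mul_div_cancel₀ _ (mul_pos hp.ρ_pos hp.c₁_pos).ne']

lemma k₂_eq : p.k₂ = p.ρ * p.c₂ * √p.α₂ ^ 2 := by
  rw [sq_sqrt hp.α₂_pos.le, α₂, mul_div_cancel₀ _ (mul_pos hp.ρ_pos hp.c₂_pos).ne']

lemma k₃_eq : p.k₃ = p.ρ * p.c₃ * √p.α₃ ^ 2 := by
  rw [sq_sqrt hp.α₃_pos.le, α₃, mul_div_cancel₀ _ (mul_pos hp.ρ_pos hp.c₃_pos).ne']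

lemma H_coeff_eq : p.Ste₂ / √π * (p.ℓ₂ / p.ℓ₁) * √(p.k₂ * p.c₁ / (p.k₁ * p.c₂)) =
    p.c₂ * (p.B - p.C) * √p.α₂ / (√π * p.ℓ₁ * √p.α₁) := by
  have h1 := sqrt_pos.2 hp.α₁_pos
  have h2 := sqrt_pos.2 hp.α₂_pos
  have := hp.ρ_pos
  have := hp.c₁_pos
  have := hp.c₂_pos
  have := hp.ℓ₁_pos
  have := hp.ℓ₂_pos
  have h : √(p.k₂ * p.c₁ / (p.k₁ * p.c₂)) = √p.α₂ / √p.α₁ := by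
    rw [← sqrt_sq (div_pos h2 h1).le]
    congr 1
    rw [hp.k₁_eq, hp.k₂_eq]
    field_simp
  rw [h, Ste₂]
  field_simp

lemma T_coeff_eq : p.Ste₂ / (√π * p.c₂) * ((p.Ainf - p.B) / (p.B - p.C)) *
      √(p.k₃ * p.c₁ * p.c₃ / p.k₁) =
    p.c₃ * (p.Ainf - p.B) * √p.α₃ / (√π * p.ℓ₂ * √p.α₁) := by
  have h1 := sqrt_pos.2 hp.α₁_pos
  have h2 := sqrt_pos.2 hp.α₃_pos
  have := hp.ρ_pos
  have := hp.c₁_pos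
  have := hp.c₂_pos
  have := hp.c₃_pos
  have := hp.ℓ₂_pos
  have := (sub_pos.2 hp.C_lt_B).ne'
  have h : √(p.k₃ * p.c₁ * p.c₃ / p.k₁) = p.c₃ * √p.α₃ / √p.α₁ := by
    rw [← sqrt_sq (by positivity : 0 ≤ p.c₃ * √p.α₃ / √p.α₁)]
    congr 1
    rw [hp.k₁_eq, hp.k₃_eq]
    field_simp
  rw [h, Ste₂]
  field_simp

lemma h₂_eq (z : ℝ) : p.h₂ z = (p.B - p.C) / (p.Ainf - p.B) * (p.ρ * p.c₂ * √p.α₂ / √π) *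
    (1 / erf (z * √(p.α₁ / p.α₂))) := by
  have := hp.ρ_pos
  have := hp.c₂_pos
  have h1 := hp.c₃_pos.ne'
  have h2 := hp.α₃_pos.ne'
  have h : √(p.k₂ * p.k₃ * p.c₂ / (π * p.c₃ * p.α₃)) = p.ρ * p.c₂ * √p.α₂ / √π := by
    rw [← sqrt_sq (by positivity : 0 ≤ p.ρ * p.c₂ * √p.α₂ / √π)]
    congr 1
    rw [hp.k₂_eq, hp.k₃_eq, sq_sqrt hp.α₃_pos.le, div_pow, sq_sqrt pi_pos.le]
    field_simp
  rw [h₂, h]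

/-- The equation `H z = e` in multiplicative form. -/
lemma H_eq_iff {z : ℝ} (hz : 0 ≤ z) (e : ℝ) : p.H z = e ↔
    (erf (z * √(p.α₁ / p.α₂)) - e) * (√π * p.ℓ₁ * √p.α₁ * p.phi z) =
      p.c₂ * (p.B - p.C) * √p.α₂ * Real.exp (-z ^ 2 * (p.α₁ / p.α₂)) := by
  have h1 := sqrt_pos.2 hp.α₁_pos
  have h2 := hp.phi_pos hz
  have h3 := hp.ℓ₁_pos
  rw [H, hp.H_coeff_eq, div_mul_div_comm, sub_eq_iff_eq_add', ← sub_eq_iff_eq_add, eq_div_iff (by positivity)]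

/-! ### The root of `Q = U` beyond the zero of `H`. -/

section Root

variable {z₀ : ℝ} (hz₀ : 0 < z₀) (hH : p.H z₀ = 0)
include hz₀ hH

lemma H_nonneg {z : ℝ} (hz : z₀ ≤ z) : 0 ≤ p.H z :=
  hH ▸ hp.H_strictMonoOn.monotoneOn hz₀.le (hz₀.le.trans hz) hz

lemma xi₂_strictMonoOn : StrictMonoOn p.xi₂ (Ici z₀) := by
  intro x hx y hy hxy
  have hx0 := hp.H_nonneg hz₀ hH hx
  have hy0 := hp.H_nonneg hz₀ hH hy
  have hx1 : x ∈ Ici (0 : ℝ) := hz₀.le.trans hx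
  have hy1 : y ∈ Ici (0 : ℝ) := hz₀.le.trans hy
  exact mul_lt_mul_of_pos_left (strictMonoOn_erfInv ⟨by linarith, hp.H_lt_one hx1⟩
    ⟨by linarith, hp.H_lt_one hy1⟩ (hp.H_strictMonoOn hx1 hy1 hxy)) hp.sqrt_ratio_inv_pos

lemma xi₂_nonneg {z : ℝ} (hz : z₀ ≤ z) : 0 ≤ p.xi₂ z :=
  xi₂_of_H_eq_zero hH ▸ (hp.xi₂_strictMonoOn hz₀ hH).monotoneOn self_mem_Ici hz hz

lemma xi₂_continuousOn : ContinuousOn p.xi₂ (Ici z₀) := by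
  intro z hz
  have hz0 : z ∈ Ici (0 : ℝ) := hz₀.le.trans hz
  have h0 := hp.H_nonneg hz₀ hH hz
  have h1 : ContinuousWithinAt p.H (Ici z₀) z :=
    (hp.H_continuousOn z hz0).mono (Ici_subset_Ici.2 hz₀.le)
  exact continuousWithinAt_const.mul
    ((continuousAt_erfInv (by linarith) (hp.H_lt_one hz0)).comp_continuousWithinAt h1)

/-- On `[z₀, ∞)` the values of `xi₂` are nonnegative and increasing, so composing with the
decreasing `T` gives a decreasing `U`. -/
lemma Q_sub_U_strictMonoOn (hα : p.α₃ < p.α₂) :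
    StrictMonoOn (fun z => p.Q z - p.U z) (Ici z₀) := by
  intro x hx y hy hxy
  have h1 := hp.Q_strictMonoOn (hz₀.le.trans hx) (hz₀.le.trans hy) hxy
  have h2 := hp.T_strictAntiOn hα (hp.xi₂_nonneg hz₀ hH hx) (hp.xi₂_nonneg hz₀ hH hy)
    (hp.xi₂_strictMonoOn hz₀ hH hx hy hxy)
  simp only [U]
  linarith

lemma Q_sub_U_continuousOn : ContinuousOn (fun z => p.Q z - p.U z) (Ici z₀) :=
  Q_continuous.continuousOn.sub (hp.T_continuousOn.comp (hp.xi₂_continuousOn hz₀ hH)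
    fun _ hz => hp.xi₂_nonneg hz₀ hH hz)

omit hp hz₀ hH in
lemma T_zero : p.T 0 = p.Ste₂ / (√π * p.c₂) * ((p.Ainf - p.B) / (p.B - p.C)) *
      √(p.k₃ * p.c₁ * p.c₃ / p.k₁) * (p.h₀ * √(π * p.α₃) / p.k₃) := by
  simp [T]

/-- The threshold `h₂` is where `Q` and `U` agree at the zero of `H`. -/
lemma Q_lt_T_zero (hh : p.h₂ z₀ < p.h₀) : p.Q z₀ < p.T 0 := by
  have hφ := hp.phi_pos hz₀.le
  have h1 := sqrt_pos.2 hp.α₁_pos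
  have h2 := sqrt_pos.2 hp.α₂_pos
  have h3 := sqrt_pos.2 hp.α₃_pos
  have := hp.ρ_pos
  have := hp.c₃_pos
  have := hp.ℓ₁_pos
  have := hp.ℓ₂_pos
  have hAB := sub_pos.2 hp.B_lt_Ainf
  have hE : 0 < erf (z₀ * √(p.α₁ / p.α₂)) := erf_pos (mul_pos hz₀ hp.sqrt_ratio_pos)
  -- `H z₀ = 0` expresses `phi z₀`, and the exponentials in `Q z₀` cancel. Since `T 0` is linear in
  -- `h₀`, the comparison is then precisely `h₂ z₀ < h₀`.
  have hQ : p.Q z₀ = p.c₂ * (p.B - p.C) * √p.α₂ /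
      (√π * p.ℓ₂ * √p.α₁ * erf (z₀ * √(p.α₁ / p.α₂))) := by
    have h := (hp.H_eq_iff hz₀.le 0).1 hH
    rw [neg_mul, Real.exp_neg, sub_zero] at h
    rw [Q]
    field_simp at h ⊢
    linear_combination h
  rw [hQ, T_zero, hp.T_coeff_eq, hp.k₃_eq, sqrt_mul pi_pos.le]
  rw [hp.h₂_eq] at hh
  rw [div_lt_iff₀ (by positivity)]
  field_simp at hh ⊢
  exact hh

lemma exists_unique_root (hα : p.α₃ < p.α₂) (hh : p.h₂ z₀ < p.h₀) :
    ∃ ξ₁, z₀ < ξ₁ ∧ p.Q ξ₁ = p.U ξ₁ ∧ ∀ z, z₀ < z → p.Q z = p.U z → z = ξ₁ := by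
  have h0 : p.Q z₀ - p.U z₀ < 0 := by
    rw [U, xi₂_of_H_eq_zero hH, sub_neg]
    exact hp.Q_lt_T_zero hz₀ hH hh
  obtain ⟨ξ, h1, h2, h3⟩ := exists_unique_zero_of_strictMonoOn
    (hp.Q_sub_U_continuousOn hz₀ hH) (hp.Q_sub_U_strictMonoOn hz₀ hH hα) h0 (by
      -- Far out, `Q b ≥ T 0 ≥ T (xi₂ b) = U b`.
      obtain ⟨b, hb, hb'⟩ := ((eventually_ge_atTop z₀).and
        (hp.tendsto_Q.eventually_ge_atTop (p.T 0))).exists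
      refine ⟨b, hb, sub_nonneg.2 (le_trans ?_ hb')⟩
      have hx := hp.xi₂_nonneg hz₀ hH hb
      exact (hp.T_strictAntiOn hα).antitoneOn self_mem_Ici hx hx)
  exact ⟨ξ, h1, sub_eq_zero.1 h2, fun z hz hQ => h3 z hz.le (sub_eq_zero.2 hQ)⟩

end Root

end Admissible

end Params

/-! ### Error-function solutions of the heat equation. -/

/-- The similarity solutions of the heat equation with diffusivity `α`. -/
noncomputable def heatProfile (α c K x t : ℝ) : ℝ := c + K * erf (x / (2 * √(α * t)))

section HeatProfile

variable {α : ℝ} (c K x : ℝ) {t : ℝ}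

lemma hasDerivAt_heatProfile (α t : ℝ) :
    HasDerivAt (fun r => heatProfile α c K r t)
      (K / (√π * √(α * t)) * Real.exp (-(x / (2 * √(α * t))) ^ 2)) x := by
  have h := ((hasDerivAt_erf (x / (2 * √(α * t)))).comp x
    ((hasDerivAt_id x).div_const (2 * √(α * t)))).const_mul K |>.const_add c
  refine h.congr_deriv ?_
  rw [show (2 * √(α * t)) = √(α * t) * 2 from mul_comm _ _, ← div_div 1]
  simp only [div_eq_mul_inv, mul_inv]
  ring

lemma deriv_heatProfile (α t : ℝ) : deriv (fun r => heatProfile α c K r t) =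
    fun x => K / (√π * √(α * t)) * Real.exp (-(x / (2 * √(α * t))) ^ 2) :=
  funext fun x => (hasDerivAt_heatProfile c K x α t).deriv

lemma heatEqAt_heatProfile (hα : 0 < α) (ht : 0 < t) :
    HeatEqAt α (heatProfile α c K) x t := by
  have hq : 0 < √(α * t) := sqrt_pos.2 (mul_pos hα ht)
  have hq2 : √(α * t) ^ 2 = α * t := sq_sqrt (mul_pos hα ht).le
  have htime : HasDerivAt (fun s => heatProfile α c K x s)
      (-(K * x * Real.exp (-(x / (2 * √(α * t))) ^ 2) / (2 * √π * t * √(α * t)))) t := by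
    have h1 : HasDerivAt (fun s => 2 * √(α * s)) (2 * (α * 1 / (2 * √(α * t)))) t :=
      (((hasDerivAt_id t).const_mul α).sqrt (mul_pos hα ht).ne').const_mul 2
    have h2 := (((hasDerivAt_erf (x / (2 * √(α * t)))).comp t
      ((hasDerivAt_const t x).fun_div h1 (by positivity))).const_mul K).const_add c
    refine h2.congr_deriv ?_
    field_simp
    rw [hq2]
    field_simp
    ring
  have hxx : HasDerivAt (deriv fun r => heatProfile α c K r t)
      (-(K * x * Real.exp (-(x / (2 * √(α * t))) ^ 2) / (2 * √π * (α * t) * √(α * t)))) x := by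
    rw [deriv_heatProfile]
    have h := ((hasDerivAt_exp_neg_sq (x / (2 * √(α * t)))).comp x
      ((hasDerivAt_id x).div_const (2 * √(α * t)))).const_mul (K / (√π * √(α * t)))
    refine h.congr_deriv ?_
    field_simp
    rw [hq2]
    ring
  refine ⟨htime.differentiableAt,
    Eventually.of_forall fun r => (hasDerivAt_heatProfile c K r α t).differentiableAt,
    hxx.differentiableAt, ?_⟩
  rw [htime.deriv, hxx.deriv]
  field_simp

lemma continuousOn_heatProfile (hα : 0 < α) :
    ContinuousOn (fun q : ℝ × ℝ => heatProfile α c K q.1 q.2) {q | 0 < q.2} := by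
  refine continuousOn_const.add (continuousOn_const.mul
    (continuous_erf.comp_continuousOn (ContinuousOn.div (by fun_prop) (by fun_prop) ?_)))
  intro q hq
  have : 0 < √(α * q.2) := sqrt_pos.2 (mul_pos hα hq)
  positivity

lemma heatProfile_injective {K : ℝ} (hK : K ≠ 0) (hα : 0 < α) (ht : 0 < t) :
    Function.Injective fun x => heatProfile α c K x t := by
  have : 0 < √(α * t) := sqrt_pos.2 (mul_pos hα ht)
  intro x y h
  have h := erf_strictMono.injective (mul_left_cancel₀ hK (add_left_cancel h))
  exact (div_left_inj' (by positivity)).1 h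

lemma tendsto_heatProfile_atTop (hα : 0 < α) (ht : 0 < t) :
    Tendsto (fun x => heatProfile α c K x t) atTop (𝓝 (c + K)) := by
  have : 0 < √(α * t) := sqrt_pos.2 (mul_pos hα ht)
  simpa [heatProfile] using ((tendsto_erf_atTop.comp
    (tendsto_id.atTop_div_const (by positivity : 0 < 2 * √(α * t)))).const_mul K).const_add c

lemma tendsto_heatProfile_initial (hα : 0 < α) {x : ℝ} (hx : 0 < x) :
    Tendsto (fun q : ℝ × ℝ => heatProfile α c K q.1 q.2) (𝓝[{q | 0 < q.2}] (x, 0))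
      (𝓝 (c + K)) := by
  have h1 : Tendsto (fun q : ℝ × ℝ => q.1) (𝓝[{q | 0 < q.2}] (x, 0)) (𝓝 x) :=
    continuous_fst.continuousWithinAt
  have h2 : Tendsto (fun q : ℝ × ℝ => 2 * √(α * q.2)) (𝓝[{q | 0 < q.2}] (x, 0)) (𝓝[>] 0) := by
    -- The denominator tends to 0 from above while the numerator stays near `x > 0`, so the argument
    -- of `erf` tends to `+∞`.
    refine tendsto_nhdsWithin_iff.2 ⟨?_, ?_⟩
    · have : Continuous fun q : ℝ × ℝ => 2 * √(α * q.2) := by fun_prop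
      simpa using (this.continuousWithinAt (s := {q | 0 < q.2}) (x := (x, 0))).tendsto
    · filter_upwards [self_mem_nhdsWithin] with q hq
      have : 0 < √(α * q.2) := sqrt_pos.2 (mul_pos hα hq)
      exact mul_pos two_pos this
  have h3 := h1.pos_mul_atTop hx (tendsto_inv_nhdsGT_zero.comp h2)
  have h4 := ((tendsto_erf_atTop.comp h3).const_mul K).const_add c
  rw [mul_one] at h4
  exact h4

lemma div_two_sqrt {α β : ℝ} (hα : 0 < α) (hβ : 0 < β) (ξ : ℝ) (ht : 0 < t) :
    2 * ξ * √(α * t) / (2 * √(β * t)) = ξ * √(α / β) := by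
  have h1 := sqrt_pos.2 hβ
  have h2 := sqrt_pos.2 ht
  rw [sqrt_mul hα.le, sqrt_mul hβ.le, sqrt_div hα.le]
  field_simp

lemma heatProfile_interface {α β : ℝ} (hα : 0 < α) (hβ : 0 < β) (c K ξ : ℝ) (ht : 0 < t) :
    heatProfile β c K (2 * ξ * √(α * t)) t = c + K * erf (ξ * √(α / β)) := by
  rw [heatProfile, div_two_sqrt hα hβ ξ ht]

lemma derivWithin_heatProfile {α β : ℝ} (hα : 0 < α) (hβ : 0 < β) (c K ξ : ℝ) (ht : 0 < t)
    {s : Set ℝ} (hs : UniqueDiffWithinAt ℝ s (2 * ξ * √(α * t))) :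
    derivWithin (fun x => heatProfile β c K x t) s (2 * ξ * √(α * t)) =
      K / (√π * √β) * Real.exp (-ξ ^ 2 * (α / β)) / √t := by
  rw [(hasDerivAt_heatProfile c K _ β t).hasDerivWithinAt.derivWithin hs,
    div_two_sqrt hα hβ ξ ht, mul_pow, sq_sqrt (div_pos hα hβ).le, sqrt_mul hβ.le, neg_mul]
  have h1 := sqrt_pos.2 hβ
  have h2 := sqrt_pos.2 ht
  field_simp

lemma derivWithin_heatProfile_zero {β : ℝ} (hβ : 0 < β) (c K : ℝ) {b : ℝ} (ht : 0 < t)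
    (hb : 0 < b) :
    derivWithin (fun x => heatProfile β c K x t) (Icc 0 b) 0 = K / (√π * √β) / √t := by
  -- The fixed face is the interface with `ξ = 0`; the diffusivity in its speed is then irrelevant.
  have h := derivWithin_heatProfile hβ hβ c K 0 ht (s := Icc 0 b)
    (by simpa using uniqueDiffOn_Icc hb 0 (left_mem_Icc.2 hb.le))
  simpa using h

lemma hasDerivAt_interface {α : ℝ} (hα : 0 < α) (ξ : ℝ) (ht : 0 < t) :
    HasDerivAt (fun t => 2 * ξ * √(α * t)) (ξ * √α / √t) t := by
  have h := (((hasDerivAt_id t).const_mul α).sqrt (mul_pos hα ht).ne').const_mul (2 * ξ)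
  refine h.congr_deriv ?_
  have h1 := sqrt_pos.2 hα
  have h2 := sqrt_pos.2 ht
  simp only [id, sqrt_mul hα.le]
  have := sq_sqrt hα.le
  field_simp
  rw [this]

end HeatProfile

/-! ### The explicit candidate and its scalar conditions. -/

namespace Params

/-- The amplitudes of the three similarity profiles. -/
noncomputable def amp₁ (p : Params) (ξ₁ : ℝ) : ℝ := -(p.C - p.D) / erfc ξ₁

noncomputable def amp₂ (p : Params) (ξ₁ ξ₂ : ℝ) : ℝ :=
  -(p.B - p.C) / (erf (ξ₁ * √(p.α₁ / p.α₂)) - erf (ξ₂ * √(p.α₁ / p.α₂)))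

noncomputable def amp₃ (p : Params) (ξ₂ : ℝ) : ℝ :=
  -(p.Ainf - p.B) / (p.k₃ / (p.h₀ * √(π * p.α₃)) + erf (ξ₂ * √(p.α₁ / p.α₃)))

end Params

/-- Applied with `r = √t`, it removes time from the Stefan conditions. -/
lemma flux_balance_div_iff {r : ℝ} (hr : r ≠ 0) (a b a' b' d e : ℝ) :
    a * (b / r) - a' * (b' / r) = d * (e / r) ↔ a * b - a' * b' = d * e := by
  rw [← mul_div_assoc, ← mul_div_assoc, ← mul_div_assoc, ← sub_div, div_left_inj' hr]

section Explicit

variable {p : Params} {ξ₁ ξ₂ : ℝ}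

/-- The offset is normalised to give the value `D` at infinity; in the other two phases it is
normalised to give `B` at the inner interface. -/
lemma explicit_Φ₁ : (explicit p ξ₁ ξ₂).Φ₁ =
    heatProfile p.α₁ (p.D - p.amp₁ ξ₁) (p.amp₁ ξ₁) := by
  funext x t
  have h := (erfc_pos ξ₁).ne'
  simp only [explicit, heatProfile, Params.amp₁]
  field_simp
  simp only [erfc]
  ring

namespace Params.Admissible

variable (hp : p.Admissible)
include hp

lemma erf_sub_pos (hξ : ξ₂ < ξ₁) :
    0 < erf (ξ₁ * √(p.α₁ / p.α₂)) - erf (ξ₂ * √(p.α₁ / p.α₂)) :=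
  sub_pos.2 (erf_strictMono (mul_lt_mul_of_pos_right hξ hp.sqrt_ratio_pos))

lemma robin_add_erf_pos (hξ : 0 < ξ₂) :
    0 < p.k₃ / (p.h₀ * √(π * p.α₃)) + erf (ξ₂ * √(p.α₁ / p.α₃)) :=
  add_pos_of_pos_of_nonneg hp.robin_coeff_pos (erf_nonneg (by positivity))

lemma explicit_Φ₂ (hξ : ξ₂ < ξ₁) : (explicit p ξ₁ ξ₂).Φ₂ =
    heatProfile p.α₂ (p.B - p.amp₂ ξ₁ ξ₂ * erf (ξ₂ * √(p.α₁ / p.α₂))) (p.amp₂ ξ₁ ξ₂) := by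
  funext x t
  have h := (hp.erf_sub_pos hξ).ne'
  simp only [explicit, heatProfile, amp₂]
  generalize erf (ξ₁ * √(p.α₁ / p.α₂)) = e₁ at *
  generalize erf (ξ₂ * √(p.α₁ / p.α₂)) = e₂ at *
  field_simp
  ring

lemma explicit_Φ₃ (hξ : 0 < ξ₂) : (explicit p ξ₁ ξ₂).Φ₃ =
    heatProfile p.α₃ (p.B - p.amp₃ ξ₂ * erf (ξ₂ * √(p.α₁ / p.α₃))) (p.amp₃ ξ₂) := by
  funext x t
  have h := (hp.robin_add_erf_pos hξ).ne'
  simp only [explicit, heatProfile, amp₃, mul_div_assoc]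
  generalize p.k₃ / (p.h₀ * √(π * p.α₃)) = κ at *
  generalize x / (2 * √(p.α₃ * t)) = u at *
  field_simp
  ring

lemma stefan₁_iff (h₂ : 0 < ξ₂) (h₁ : ξ₂ < ξ₁) :
    p.k₁ * (p.amp₁ ξ₁ / (√π * √p.α₁) * Real.exp (-ξ₁ ^ 2)) -
      p.k₂ * (p.amp₂ ξ₁ ξ₂ / (√π * √p.α₂) * Real.exp (-ξ₁ ^ 2 * (p.α₁ / p.α₂))) =
        p.δ₁ * (ξ₁ * √p.α₁) ↔ p.H ξ₁ = erf (ξ₂ * √(p.α₁ / p.α₂)) := by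
  have h1 := sqrt_pos.2 hp.α₁_pos
  have h2 := sqrt_pos.2 hp.α₂_pos
  have h3 := hp.ρ_pos
  have h4 := hp.ℓ₁_pos
  have h5 := erfc_pos ξ₁
  have h6 := hp.erf_sub_pos h₁
  have h7 : 0 < √π := by positivity
  rw [hp.H_eq_iff (h₂.trans h₁).le, phi, Ste₁, amp₁, amp₂, hp.k₁_eq, hp.k₂_eq, δ₁]
  generalize erf (ξ₁ * √(p.α₁ / p.α₂)) - erf (ξ₂ * √(p.α₁ / p.α₂)) = Δ at *
  generalize Real.exp (-ξ₁ ^ 2 * (p.α₁ / p.α₂)) = E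
  field_simp
  constructor <;> intro h <;> linear_combination -h

/-- The outer equation `hH` is needed to eliminate `phi ξ₁` from `Q ξ₁`. What is left is the flux
balance divided by `exp (-ξ₂² α₁/α₂)`, up to a constant factor. -/
lemma stefan₂_iff (h₂ : 0 < ξ₂) (h₁ : ξ₂ < ξ₁)
    (hH : p.H ξ₁ = erf (ξ₂ * √(p.α₁ / p.α₂))) :
    p.k₂ * (p.amp₂ ξ₁ ξ₂ / (√π * √p.α₂) * Real.exp (-ξ₂ ^ 2 * (p.α₁ / p.α₂))) -
      p.k₃ * (p.amp₃ ξ₂ / (√π * √p.α₃) * Real.exp (-ξ₂ ^ 2 * (p.α₁ / p.α₃))) =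
        p.δ₂ * (ξ₂ * √p.α₁) ↔ p.Q ξ₁ = p.T ξ₂ := by
  have h1 := sqrt_pos.2 hp.α₁_pos
  have h2 := sqrt_pos.2 hp.α₂_pos
  have h2' := sqrt_pos.2 hp.α₃_pos
  have h3 := hp.ρ_pos
  have h4 := hp.ℓ₁_pos
  have h4' := hp.ℓ₂_pos
  have h6 := hp.erf_sub_pos h₁
  have h8 := hp.robin_add_erf_pos h₂
  have h7 : 0 < √π := by positivity
  have hH' := (hp.H_eq_iff (h₂.trans h₁).le _).1 hH
  have e1 : Real.exp (-ξ₂ ^ 2 * p.α₁ * (1 / p.α₃ - 1 / p.α₂)) =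
      Real.exp (-ξ₂ ^ 2 * (p.α₁ / p.α₃)) / Real.exp (-ξ₂ ^ 2 * (p.α₁ / p.α₂)) := by
    rw [← Real.exp_sub]
    congr 1
    ring
  have e2 : Real.exp (ξ₂ ^ 2 * (p.α₁ / p.α₂)) = 1 / Real.exp (-ξ₂ ^ 2 * (p.α₁ / p.α₂)) := by
    rw [neg_mul, Real.exp_neg, one_div, inv_inv]
  have e3 : Real.exp (ξ₁ ^ 2 * (p.α₁ / p.α₂)) = 1 / Real.exp (-ξ₁ ^ 2 * (p.α₁ / p.α₂)) := by
    rw [neg_mul, Real.exp_neg, one_div, inv_inv]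
  have hφ : p.phi ξ₁ = p.c₂ * (p.B - p.C) * √p.α₂ * Real.exp (-ξ₁ ^ 2 * (p.α₁ / p.α₂)) /
      ((erf (ξ₁ * √(p.α₁ / p.α₂)) - erf (ξ₂ * √(p.α₁ / p.α₂))) * (√π * p.ℓ₁ * √p.α₁)) := by
    rw [eq_div_iff (by positivity), ← hH']
    ring
  rw [Q, T, hp.T_coeff_eq, e1, e2, e3, hφ, amp₂, amp₃, δ₂]
  generalize p.k₃ / (p.h₀ * √(π * p.α₃)) + erf (ξ₂ * √(p.α₁ / p.α₃)) = κ at *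
  rw [hp.k₂_eq, hp.k₃_eq]
  have hE1 := Real.exp_pos (-ξ₁ ^ 2 * (p.α₁ / p.α₂))
  have hE2 := Real.exp_pos (-ξ₂ ^ 2 * (p.α₁ / p.α₂))
  generalize erf (ξ₁ * √(p.α₁ / p.α₂)) - erf (ξ₂ * √(p.α₁ / p.α₂)) = Δ at *
  generalize Real.exp (-ξ₁ ^ 2 * (p.α₁ / p.α₂)) = E₁ at *
  generalize Real.exp (-ξ₂ ^ 2 * (p.α₁ / p.α₂)) = E₂ at *
  generalize Real.exp (-ξ₂ ^ 2 * (p.α₁ / p.α₃)) = E₃ at *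
  generalize √p.α₁ = s₁ at *
  generalize √p.α₂ = s₂ at *
  generalize √p.α₃ = s₃ at *
  field_simp
  constructor <;> intro h <;> linear_combination -h

lemma interface_pos {ξ : ℝ} (hξ : 0 < ξ) {t : ℝ} (ht : 0 < t) : 0 < 2 * ξ * √(p.α₁ * t) := by
  have := sqrt_pos.2 (mul_pos hp.α₁_pos ht)
  positivity

lemma interface_lt (h : ξ₂ < ξ₁) {t : ℝ} (ht : 0 < t) :
    2 * ξ₂ * √(p.α₁ * t) < 2 * ξ₁ * √(p.α₁ * t) := by
  have := sqrt_pos.2 (mul_pos hp.α₁_pos ht)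
  gcongr

/-- The Stefan condition of the explicit solution at the outer interface. -/
lemma explicit_stefan₁_iff (h₂ : 0 < ξ₂) (h₁ : ξ₂ < ξ₁) {t : ℝ} (ht : 0 < t) :
    let s := explicit p ξ₁ ξ₂
    p.k₁ * derivWithin (fun x => s.Φ₁ x t) (Ici (s.y₁ t)) (s.y₁ t) -
      p.k₂ * derivWithin (fun x => s.Φ₂ x t) (Icc (s.y₂ t) (s.y₁ t)) (s.y₁ t) =
        p.δ₁ * deriv s.y₁ t ↔ p.H ξ₁ = erf (ξ₂ * √(p.α₁ / p.α₂)) := by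
  intro s
  have hlt := hp.interface_lt h₁ ht
  have hst := sqrt_pos.2 ht
  rw [← hp.stefan₁_iff h₂ h₁]
  simp only [s, explicit_Φ₁, hp.explicit_Φ₂ h₁]
  simp only [explicit]
  rw [derivWithin_heatProfile hp.α₁_pos hp.α₁_pos _ _ _ ht (uniqueDiffOn_Ici _ _ self_mem_Ici),
    derivWithin_heatProfile hp.α₁_pos hp.α₂_pos _ _ _ ht
      (uniqueDiffOn_Icc hlt _ (right_mem_Icc.2 hlt.le)),
    (hasDerivAt_interface hp.α₁_pos ξ₁ ht).deriv, div_self hp.α₁_pos.ne', mul_one,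
    flux_balance_div_iff hst.ne']

/-- The Stefan condition of the explicit solution at the inner interface. -/
lemma explicit_stefan₂_iff (h₂ : 0 < ξ₂) (h₁ : ξ₂ < ξ₁)
    (hH : p.H ξ₁ = erf (ξ₂ * √(p.α₁ / p.α₂))) {t : ℝ} (ht : 0 < t) :
    let s := explicit p ξ₁ ξ₂
    p.k₂ * derivWithin (fun x => s.Φ₂ x t) (Icc (s.y₂ t) (s.y₁ t)) (s.y₂ t) -
      p.k₃ * derivWithin (fun x => s.Φ₃ x t) (Icc 0 (s.y₂ t)) (s.y₂ t) = p.δ₂ * deriv s.y₂ t ↔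
        p.Q ξ₁ = p.T ξ₂ := by
  intro s
  have hlt := hp.interface_lt h₁ ht
  have hpos := hp.interface_pos h₂ ht
  have hst := sqrt_pos.2 ht
  rw [← hp.stefan₂_iff h₂ h₁ hH]
  simp only [s, hp.explicit_Φ₂ h₁, hp.explicit_Φ₃ h₂]
  simp only [explicit]
  rw [derivWithin_heatProfile hp.α₁_pos hp.α₂_pos _ _ _ ht
      (uniqueDiffOn_Icc hlt _ (left_mem_Icc.2 hlt.le)),
    derivWithin_heatProfile hp.α₁_pos hp.α₃_pos _ _ _ ht
      (uniqueDiffOn_Icc hpos _ (right_mem_Icc.2 hpos.le)),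
    (hasDerivAt_interface hp.α₁_pos ξ₂ ht).deriv,
    flux_balance_div_iff hst.ne']

/-- The convective condition together with the phase change temperature determines a profile. -/
lemma robin_iff (h₂ : 0 < ξ₂) {c K t : ℝ} (ht : 0 < t)
    (hB : c + K * erf (ξ₂ * √(p.α₁ / p.α₃)) = p.B) :
    p.k₃ * (K / (√π * √p.α₃) / √t) = p.h₀ / √t * (c - p.Ainf) ↔ K = p.amp₃ ξ₂ := by
  have h3 := sqrt_pos.2 hp.α₃_pos
  have hst := sqrt_pos.2 ht
  have h4 := hp.h₀_pos
  have h5 := hp.robin_add_erf_pos h₂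
  obtain rfl : c = p.B - K * erf (ξ₂ * √(p.α₁ / p.α₃)) := by linarith
  rw [amp₃, eq_div_iff h5.ne', sqrt_mul pi_pos.le]
  generalize erf (ξ₂ * √(p.α₁ / p.α₃)) = e
  field_simp
  constructor <;> intro h <;> linear_combination h

lemma explicit_isSolution (h₂ : 0 < ξ₂) (h₁ : ξ₂ < ξ₁)
    (hH : p.H ξ₁ = erf (ξ₂ * √(p.α₁ / p.α₂))) (hQ : p.Q ξ₁ = p.T ξ₂) :
    IsSolution p (explicit p ξ₁ ξ₂) where
  y₂_pos _ ht := hp.interface_pos h₂ ht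
  y₂_lt_y₁ _ ht := hp.interface_lt h₁ ht
  y₁_cont := by simp only [explicit]; fun_prop
  y₂_cont := by simp only [explicit]; fun_prop
  y₁_diff _ ht := (hasDerivAt_interface hp.α₁_pos ξ₁ ht).differentiableAt
  y₂_diff _ ht := (hasDerivAt_interface hp.α₁_pos ξ₂ ht).differentiableAt
  Φ₃_cont := by
    rw [hp.explicit_Φ₃ h₂]
    exact (continuousOn_heatProfile _ _ hp.α₃_pos).mono fun _ h => h.1
  Φ₂_cont := by
    rw [hp.explicit_Φ₂ h₁]
    exact (continuousOn_heatProfile _ _ hp.α₂_pos).mono fun _ h => h.1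
  Φ₁_cont := by
    rw [explicit_Φ₁]
    exact (continuousOn_heatProfile _ _ hp.α₁_pos).mono fun _ h => h.1
  Φ₃_diff t _ x _ := by
    rw [hp.explicit_Φ₃ h₂]
    exact (hasDerivAt_heatProfile _ _ x _ t).differentiableAt.differentiableWithinAt
  Φ₂_diff t _ x _ := by
    rw [hp.explicit_Φ₂ h₁]
    exact (hasDerivAt_heatProfile _ _ x _ t).differentiableAt.differentiableWithinAt
  Φ₁_diff t _ x _ := by
    rw [explicit_Φ₁]
    exact (hasDerivAt_heatProfile _ _ x _ t).differentiableAt.differentiableWithinAt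
  heat₃ x t ht _ _ := by
    rw [hp.explicit_Φ₃ h₂]
    exact heatEqAt_heatProfile _ _ x hp.α₃_pos ht
  heat₂ x t ht _ _ := by
    rw [hp.explicit_Φ₂ h₁]
    exact heatEqAt_heatProfile _ _ x hp.α₂_pos ht
  heat₁ x t ht _ := by
    rw [explicit_Φ₁]
    exact heatEqAt_heatProfile _ _ x hp.α₁_pos ht
  Φ₃_y₂ t ht := by
    rw [hp.explicit_Φ₃ h₂]
    exact (heatProfile_interface hp.α₁_pos hp.α₃_pos _ _ ξ₂ ht).trans (sub_add_cancel _ _)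
  Φ₂_y₂ t ht := by
    rw [hp.explicit_Φ₂ h₁]
    exact (heatProfile_interface hp.α₁_pos hp.α₂_pos _ _ ξ₂ ht).trans (sub_add_cancel _ _)
  Φ₂_y₁ t ht := by
    rw [hp.explicit_Φ₂ h₁]
    refine (heatProfile_interface hp.α₁_pos hp.α₂_pos _ _ ξ₁ ht).trans ?_
    have := (hp.erf_sub_pos h₁).ne'
    rw [sub_add_eq_add_sub, add_sub_assoc, ← mul_sub, amp₂, div_mul_cancel₀ _ this]
    ring
  Φ₁_y₁ t ht := by
    rw [explicit_Φ₁]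
    refine (heatProfile_interface hp.α₁_pos hp.α₁_pos _ _ ξ₁ ht).trans ?_
    have h : p.amp₁ ξ₁ * erfc ξ₁ = -(p.C - p.D) := div_mul_cancel₀ _ (erfc_pos ξ₁).ne'
    rw [erfc] at h
    rw [div_self hp.α₁_pos.ne', sqrt_one, mul_one]
    linarith
  initial x hx := by
    rw [explicit_Φ₁]
    simpa using (tendsto_heatProfile_initial (p.D - p.amp₁ ξ₁) (p.amp₁ ξ₁) hp.α₁_pos hx).mono_left
      (nhdsWithin_mono _ fun q hq => hq.1)
  infinity t ht := by
    rw [explicit_Φ₁]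
    simpa using tendsto_heatProfile_atTop (p.D - p.amp₁ ξ₁) (p.amp₁ ξ₁) hp.α₁_pos ht
  stefan₂ _ ht := (hp.explicit_stefan₂_iff h₂ h₁ hH ht).2 hQ
  stefan₁ _ ht := (hp.explicit_stefan₁_iff h₂ h₁ ht).2 hH
  y₁_zero := by simp [explicit]
  y₂_zero := by simp [explicit]
  robin t ht := by
    rw [hp.explicit_Φ₃ h₂, derivWithin_heatProfile_zero (b := (explicit p ξ₁ ξ₂).y₂ t)
      hp.α₃_pos _ _ ht (hp.interface_pos h₂ ht)]
    simpa [heatProfile] using (hp.robin_iff h₂ ht (sub_add_cancel p.B _)).2 rfl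

lemma explicit_isSimilarityType (h₂ : 0 < ξ₂) (h₁ : ξ₂ < ξ₁) :
    IsSimilarityType (explicit p ξ₁ ξ₂) := by
  have key : ∀ {α : ℝ} (c K x : ℝ) {t : ℝ}, 0 < α → 0 < t →
      heatProfile α c K x t = heatProfile α c K (x / √t) 1 := by
    intro α c K x t hα ht
    have := sqrt_pos.2 hα
    have := sqrt_pos.2 ht
    rw [heatProfile, heatProfile, sqrt_mul hα.le, mul_one]
    congr 3
    field_simp
  refine ⟨fun η => (explicit p ξ₁ ξ₂).Φ₁ η 1, fun η => (explicit p ξ₁ ξ₂).Φ₂ η 1,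
    fun η => (explicit p ξ₁ ξ₂).Φ₃ η 1, fun t ht => ⟨fun x _ => ?_, fun x _ => ?_, fun x _ => ?_⟩⟩
  · rw [hp.explicit_Φ₃ h₂]
    exact key _ _ x hp.α₃_pos ht
  · rw [hp.explicit_Φ₂ h₁]
    exact key _ _ x hp.α₂_pos ht
  · rw [explicit_Φ₁]
    exact key _ _ x hp.α₁_pos ht

end Params.Admissible

end Explicit

/-! ### From similarity to error-function profiles. -/

/-- The spatial profiles of similarity solutions of the heat equation, from their ODE. -/
lemma exists_heatProfile_of_ode {α T : ℝ} (hα : 0 < α) (hT : 0 < T) {g : ℝ → ℝ} {S : Set ℝ}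
    (hconv : Convex ℝ S) (hne : (interior S).Nonempty) (hg : ContinuousOn g S)
    (hd : ∀ x ∈ interior S, DifferentiableAt ℝ g x)
    (hode : ∀ x ∈ interior S, HasDerivAt (deriv g) (-(x / (2 * T)) * deriv g x / α) x) :
    ∃ c K, ∀ x ∈ S, g x = heatProfile α c K x T := by
  have hq : 0 < √(α * T) := sqrt_pos.2 (mul_pos hα hT)
  have hq2 : √(α * T) ^ 2 = α * T := sq_sqrt (mul_pos hα hT).le
  have hpc : IsPreconnected (interior S) := hconv.interior.isPreconnected
  have hexp : ∀ x, HasDerivAt (fun x => Real.exp ((x / (2 * √(α * T))) ^ 2))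
      (x / (2 * (α * T)) * Real.exp ((x / (2 * √(α * T))) ^ 2)) x := by
    intro x
    have h := (((hasDerivAt_id x).div_const (2 * √(α * T))).fun_pow 2).exp
    refine h.congr_deriv ?_
    simp only [id, Nat.add_one_sub_one, pow_one, Nat.cast_ofNat]
    field_simp
    rw [hq2]
    ring
  -- `exp (x²/(4αT))` is the integrating factor of the ODE for `deriv g`.
  have h1 : ∀ x ∈ interior S,
      HasDerivAt (fun x => deriv g x * Real.exp ((x / (2 * √(α * T))) ^ 2)) 0 x := by
    intro x hx
    refine ((hode x hx).mul (hexp x)).congr_deriv ?_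
    field_simp
    ring
  obtain ⟨M, hM⟩ := isOpen_interior.exists_is_const_of_deriv_eq_zero hpc
    (fun x hx => (h1 x hx).differentiableAt.differentiableWithinAt) (fun x hx => (h1 x hx).deriv)
  -- Chosen so that the profile with amplitude `K` has the same derivative as `g`.
  set K := M * (√π * √(α * T)) with hK
  have h2 : ∀ x ∈ interior S, HasDerivAt (fun x => g x - heatProfile α 0 K x T) 0 x := by
    intro x hx
    refine ((hd x hx).hasDerivAt.sub (hasDerivAt_heatProfile 0 K x α T)).congr_deriv ?_
    have : √π ≠ 0 := by positivity
    rw [hK, ← hM x hx, Real.exp_neg]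
    field_simp
    ring
  obtain ⟨c, hc⟩ := isOpen_interior.exists_is_const_of_deriv_eq_zero hpc
    (fun x hx => (h2 x hx).differentiableAt.differentiableWithinAt) (fun x hx => (h2 x hx).deriv)
  refine ⟨c, K, ?_⟩
  have hcont : Continuous fun x => heatProfile α c K x T :=
    continuous_iff_continuousAt.2 fun x => (hasDerivAt_heatProfile c K x α T).continuousAt
  refine EqOn.of_subset_closure (s := interior S) ?_ hg hcont.continuousOn interior_subset ?_
  · intro x hx
    have := hc x hx
    simp only [heatProfile] at this ⊢
    linarith
  · rw [hconv.closure_interior_eq_closure_of_nonempty_interior hne]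
    exact subset_closure

/-- In a phase `S`, a similarity solution of the heat equation is at each time an
error function profile. -/
lemma exists_heatProfile_of_similarity {α T : ℝ} (hα : 0 < α) (hT : 0 < T) {Φ : ℝ → ℝ → ℝ}
    {f : ℝ → ℝ} {S : ℝ → Set ℝ} (hf : ∀ t, 0 < t → ∀ x ∈ S t, Φ x t = f (x / √t))
    (hconv : Convex ℝ (S T)) (hne : (interior (S T)).Nonempty)
    (hcont : ContinuousOn (fun x => Φ x T) (S T))
    (hS : ∀ x ∈ interior (S T), ∀ᶠ s in 𝓝 T, x ∈ S s)
    (hheat : ∀ x ∈ interior (S T), HeatEqAt α Φ x T) :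
    ∃ c K, ∀ x ∈ S T, Φ x T = heatProfile α c K x T := by
  refine exists_heatProfile_of_ode hα hT hconv hne hcont
    (fun x hx => (hheat x hx).2.1.self_of_nhds) fun x hx => ?_
  obtain ⟨-, hg, hg', heq⟩ := hheat x hx
  have hsT := sqrt_pos.2 hT
  have hscale : HasDerivAt (fun s => x * √T / √s) (-(x / (2 * T))) T := by
    have h := (hasDerivAt_const T (x * √T)).fun_div ((hasDerivAt_id T).sqrt hT.ne') hsT.ne'
    refine h.congr_deriv ?_
    have h2 := sq_sqrt hT.le
    simp only [id]
    rw [h2]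
    field_simp
    ring
  have hval : x * √T / √T = x := mul_div_cancel_right₀ x hsT.ne'
  -- The profile `f` has no assumed regularity, so it is never differentiated. A change of time is
  -- traded for a change of position at the fixed time `T`, giving `Φ_t = -(x / 2T) Φ_x`.
  have hev : (fun s => Φ x s) =ᶠ[𝓝 T] fun s => Φ (x * √T / √s) T := by
    have hmem : ∀ᶠ s in 𝓝 T, x * √T / √s ∈ interior (S T) :=
      hscale.continuousAt.eventually_mem (hval.symm ▸ isOpen_interior.mem_nhds hx)
    filter_upwards [hS x hx, hmem, eventually_gt_nhds hT] with s h1 h2 h3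
    rw [hf s h3 x h1, hf T hT _ (interior_subset h2), div_right_comm, hval]
  have htime : HasDerivAt (fun s => Φ (x * √T / √s) T)
      (deriv (fun r => Φ r T) x * -(x / (2 * T))) T := 
    hg.self_of_nhds.hasDerivAt.comp_of_eq T hscale hval.symm
  rw [hev.deriv_eq, htime.deriv] at heq
  refine hg'.hasDerivAt.congr_deriv ?_
  rw [eq_div_iff hα.ne']
  linarith

/-! ### Rigidity of similarity solutions. -/

namespace IsSolution

variable {p : Params} {s : Candidate} (hs : IsSolution p s)
include hs

/-- Continuity of the interface keeps an interior point inside the phase at nearby times. Here `c`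
and `K` may still depend on `t`. -/
lemma exists_profile₃ (hp : p.Admissible) {f : ℝ → ℝ}
    (hf : ∀ t, 0 < t → ∀ x ∈ Icc 0 (s.y₂ t), s.Φ₃ x t = f (x / √t)) {t : ℝ} (ht : 0 < t) :
    ∃ c K, ∀ x ∈ Icc 0 (s.y₂ t), s.Φ₃ x t = heatProfile p.α₃ c K x t := by
  refine exists_heatProfile_of_similarity (S := fun t => Icc 0 (s.y₂ t)) hp.α₃_pos ht hf
    (convex_Icc _ _) ?_ (hs.Φ₃_diff t ht).continuousOn ?_ ?_
  · simpa using hs.y₂_pos t ht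
  · intro x hx
    rw [interior_Icc] at hx
    filter_upwards [(hs.y₂_diff t ht).continuousAt.eventually (eventually_gt_nhds hx.2)] with r hr
    exact ⟨hx.1.le, hr.le⟩
  · intro x hx
    rw [interior_Icc] at hx
    exact hs.heat₃ x t ht hx.1 hx.2

lemma exists_profile₂ (hp : p.Admissible) {f : ℝ → ℝ}
    (hf : ∀ t, 0 < t → ∀ x ∈ Icc (s.y₂ t) (s.y₁ t), s.Φ₂ x t = f (x / √t)) {t : ℝ}
    (ht : 0 < t) :
    ∃ c K, ∀ x ∈ Icc (s.y₂ t) (s.y₁ t), s.Φ₂ x t = heatProfile p.α₂ c K x t := by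
  refine exists_heatProfile_of_similarity (S := fun t => Icc (s.y₂ t) (s.y₁ t)) hp.α₂_pos ht hf
    (convex_Icc _ _) ?_ (hs.Φ₂_diff t ht).continuousOn ?_ ?_
  · simpa using hs.y₂_lt_y₁ t ht
  · intro x hx
    rw [interior_Icc] at hx
    filter_upwards [(hs.y₂_diff t ht).continuousAt.eventually (eventually_lt_nhds hx.1),
      (hs.y₁_diff t ht).continuousAt.eventually (eventually_gt_nhds hx.2)] with r hr hr'
    exact ⟨hr.le, hr'.le⟩
  · intro x hx
    rw [interior_Icc] at hx
    exact hs.heat₂ x t ht hx.1 hx.2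

lemma exists_profile₁ (hp : p.Admissible) {f : ℝ → ℝ}
    (hf : ∀ t, 0 < t → ∀ x ∈ Ici (s.y₁ t), s.Φ₁ x t = f (x / √t)) {t : ℝ} (ht : 0 < t) :
    ∃ c K, ∀ x ∈ Ici (s.y₁ t), s.Φ₁ x t = heatProfile p.α₁ c K x t := by
  refine exists_heatProfile_of_similarity (S := fun t => Ici (s.y₁ t)) hp.α₁_pos ht hf
    (convex_Ici _) ?_ (hs.Φ₁_diff t ht).continuousOn ?_ ?_
  · simp
  · intro x hx
    rw [interior_Ici] at hx
    filter_upwards [(hs.y₁_diff t ht).continuousAt.eventually (eventually_lt_nhds hx)] with r hr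
    exact hr.le
  · intro x hx
    rw [interior_Ici] at hx
    exact hs.heat₁ x t ht hx

lemma robin_of_profile (hp : p.Admissible) {t c K : ℝ} (ht : 0 < t)
    (h : ∀ x ∈ Icc 0 (s.y₂ t), s.Φ₃ x t = heatProfile p.α₃ c K x t) :
    p.k₃ * (K / (√π * √p.α₃) / √t) = p.h₀ / √t * (c - p.Ainf) := by
  have hy := hs.y₂_pos t ht
  have h0 : (0 : ℝ) ∈ Icc 0 (s.y₂ t) := left_mem_Icc.2 hy.le
  have hr := hs.robin t ht
  rw [derivWithin_congr h (h 0 h0), h 0 h0,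
    derivWithin_heatProfile_zero hp.α₃_pos c K ht hy] at hr
  simpa [heatProfile] using hr

/-- If it failed, the time-`t` profile would take the value `B` twice: at `y₂ t` and at the rescaled
point `y₂ r / √r * √t` inside the phase. This contradicts injectivity, as `K ≠ 0`. Exchanging `t`
and `r` gives equality. -/
lemma y₂_div_sqrt_le (hp : p.Admissible) {f : ℝ → ℝ}
    (hf : ∀ t, 0 < t → ∀ x ∈ Icc 0 (s.y₂ t), s.Φ₃ x t = f (x / √t)) {t r : ℝ} (ht : 0 < t)
    (hr : 0 < r) : s.y₂ t / √t ≤ s.y₂ r / √r := by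
  by_contra! hlt
  have hst := sqrt_pos.2 ht
  have hsr := sqrt_pos.2 hr
  have hyt := hs.y₂_pos t ht
  have hyr := hs.y₂_pos r hr
  obtain ⟨c, K, h⟩ := hs.exists_profile₃ hp hf ht
  have hx : s.y₂ r / √r * √t < s.y₂ t := (lt_div_iff₀ hst).1 hlt
  have hmem : s.y₂ r / √r * √t ∈ Icc 0 (s.y₂ t) := ⟨by positivity, hx.le⟩
  have hmem' := right_mem_Icc.2 hyt.le
  have e : s.Φ₃ (s.y₂ r / √r * √t) t = s.Φ₃ (s.y₂ t) t := by
    rw [hf t ht _ hmem, mul_div_cancel_right₀ _ hst.ne',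
      ← hf r hr _ (right_mem_Icc.2 hyr.le), hs.Φ₃_y₂ r hr, hs.Φ₃_y₂ t ht]
  -- A constant profile would equal `B` and have zero flux at the face, so the convective condition
  -- would give `B = Ainf`.
  have hK : K ≠ 0 := by
    rintro rfl
    have h1 := hs.robin_of_profile hp ht h
    have h2 := h _ hmem'
    rw [hs.Φ₃_y₂ t ht, heatProfile, zero_mul, add_zero] at h2
    have h3 : 0 < p.h₀ / √t * (p.Ainf - c) :=
      mul_pos (div_pos hp.h₀_pos hst) (sub_pos.2 (h2 ▸ hp.B_lt_Ainf))
    rw [zero_div, zero_div, mul_zero] at h1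
    linarith
  rw [h _ hmem, h _ hmem'] at e
  exact hx.ne (heatProfile_injective c hK hp.α₃_pos ht e)

lemma y₁_div_sqrt_le (hp : p.Admissible) {f : ℝ → ℝ}
    (hf : ∀ t, 0 < t → ∀ x ∈ Icc (s.y₂ t) (s.y₁ t), s.Φ₂ x t = f (x / √t)) {t r : ℝ}
    (ht : 0 < t) (hr : 0 < r) (h₂ : s.y₂ t / √t ≤ s.y₂ r / √r) :
    s.y₁ t / √t ≤ s.y₁ r / √r := by
  by_contra! hlt
  have hst := sqrt_pos.2 ht
  have hsr := sqrt_pos.2 hr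
  have hyt := hs.y₂_lt_y₁ t ht
  have hyr := hs.y₂_lt_y₁ r hr
  obtain ⟨c, K, h⟩ := hs.exists_profile₂ hp hf ht
  have hx : s.y₁ r / √r * √t < s.y₁ t := (lt_div_iff₀ hst).1 hlt
  -- The comparison of the inner interfaces is what keeps the rescaled point in phase 2 at time `t`.
  have hx' : s.y₂ t ≤ s.y₁ r / √r * √t :=
    (div_le_iff₀ hst).1 (h₂.trans (div_le_div_of_nonneg_right hyr.le hsr.le))
  have hmem : s.y₁ r / √r * √t ∈ Icc (s.y₂ t) (s.y₁ t) := ⟨hx', hx.le⟩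
  have hmem' := right_mem_Icc.2 hyt.le
  have e : s.Φ₂ (s.y₁ r / √r * √t) t = s.Φ₂ (s.y₁ t) t := by
    rw [hf t ht _ hmem, mul_div_cancel_right₀ _ hst.ne',
      ← hf r hr _ (right_mem_Icc.2 hyr.le), hs.Φ₂_y₁ r hr, hs.Φ₂_y₁ t ht]
  have hK : K ≠ 0 := by
    rintro rfl
    have h1 := h _ (left_mem_Icc.2 hyt.le)
    have h2 := h _ hmem'
    rw [hs.Φ₂_y₂ t ht, heatProfile, zero_mul, add_zero] at h1
    rw [hs.Φ₂_y₁ t ht, heatProfile, zero_mul, add_zero] at h2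
    exact hp.C_lt_B.ne (h2.trans h1.symm)
  rw [h _ hmem, h _ hmem'] at e
  exact hx.ne (heatProfile_injective c hK hp.α₂_pos ht e)

/-- A solution of similarity type is explicit. -/
lemma exists_same_explicit (hp : p.Admissible) (hsim : IsSimilarityType s) :
    ∃ ξ₁ ξ₂, 0 < ξ₂ ∧ ξ₂ < ξ₁ ∧ Same s (explicit p ξ₁ ξ₂) := by
  obtain ⟨f₁, f₂, f₃, hf⟩ := hsim
  have hf₁ := fun t ht => (hf t ht).2.2
  have hf₂ := fun t ht => (hf t ht).2.1
  have hf₃ := fun t ht => (hf t ht).1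
  have hs1 := sqrt_pos.2 hp.α₁_pos
  have e₂ : ∀ t, 0 < t → s.y₂ t / √t = s.y₂ 1 / √1 := fun t ht =>
    (hs.y₂_div_sqrt_le hp hf₃ ht one_pos).antisymm (hs.y₂_div_sqrt_le hp hf₃ one_pos ht)
  have e₁ : ∀ t, 0 < t → s.y₁ t / √t = s.y₁ 1 / √1 := fun t ht =>
    (hs.y₁_div_sqrt_le hp hf₂ ht one_pos (e₂ t ht).le).antisymm
      (hs.y₁_div_sqrt_le hp hf₂ one_pos ht (e₂ t ht).ge)
  have key : ∀ {y : ℝ → ℝ}, y 0 = 0 → (∀ t, 0 < t → y t / √t = y 1 / √1) → ∀ t, 0 ≤ t →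
      y t = 2 * (y 1 / (2 * √p.α₁)) * √(p.α₁ * t) := by
    intro y h0 h t ht
    rcases ht.eq_or_lt with rfl | ht
    · simp [h0]
    · have := sqrt_pos.2 ht
      have h := h t ht
      rw [sqrt_one, div_one, div_eq_iff this.ne'] at h
      rw [h, sqrt_mul hp.α₁_pos.le]
      field_simp
  obtain ⟨ξ₂, hξ₂⟩ : ∃ ξ, ξ = s.y₂ 1 / (2 * √p.α₁) := ⟨_, rfl⟩
  obtain ⟨ξ₁, hξ₁⟩ : ∃ ξ, ξ = s.y₁ 1 / (2 * √p.α₁) := ⟨_, rfl⟩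
  have hy₂ := hξ₂ ▸ key hs.y₂_zero e₂
  have hy₁ := hξ₁ ▸ key hs.y₁_zero e₁
  have h₂ : 0 < ξ₂ := by
    have := hs.y₂_pos 1 one_pos
    rw [hξ₂]
    positivity
  have h₁ : ξ₂ < ξ₁ := by
    rw [hξ₁, hξ₂]
    exact div_lt_div_of_pos_right (hs.y₂_lt_y₁ 1 one_pos) (by positivity)
  refine ⟨ξ₁, ξ₂, h₂, h₁, fun t ht => ⟨hy₁ t ht, hy₂ t ht⟩, fun t ht => ?_⟩
  have hy₁t : (explicit p ξ₁ ξ₂).y₁ t = s.y₁ t := (hy₁ t ht.le).symm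
  have hy₂t : (explicit p ξ₁ ξ₂).y₂ t = s.y₂ t := (hy₂ t ht.le).symm
  have hpos := hs.y₂_pos t ht
  have hlt := hs.y₂_lt_y₁ t ht
  rw [hy₁t, hy₂t, hp.explicit_Φ₃ h₂, hp.explicit_Φ₂ h₁, explicit_Φ₁]
  refine ⟨?_, ?_, ?_⟩
  · obtain ⟨c, K, h⟩ := hs.exists_profile₃ hp hf₃ ht
    have hB := h _ (right_mem_Icc.2 hpos.le)
    rw [hs.Φ₃_y₂ t ht, hy₂ t ht.le, heatProfile_interface hp.α₁_pos hp.α₃_pos _ _ _ ht] at hB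
    obtain rfl := (hp.robin_iff h₂ ht hB.symm).1 (hs.robin_of_profile hp ht h)
    rwa [hB, add_sub_cancel_right]
  · obtain ⟨c, K, h⟩ := hs.exists_profile₂ hp hf₂ ht
    have hB := h _ (left_mem_Icc.2 hlt.le)
    have hC := h _ (right_mem_Icc.2 hlt.le)
    rw [hs.Φ₂_y₂ t ht, hy₂ t ht.le, heatProfile_interface hp.α₁_pos hp.α₂_pos _ _ _ ht] at hB
    rw [hs.Φ₂_y₁ t ht, hy₁ t ht.le, heatProfile_interface hp.α₁_pos hp.α₂_pos _ _ _ ht] at hC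
    obtain rfl : K = p.amp₂ ξ₁ ξ₂ := by
      rw [Params.amp₂, eq_div_iff (hp.erf_sub_pos h₁).ne']
      linarith
    rwa [hB, add_sub_cancel_right]
  · obtain ⟨c, K, h⟩ := hs.exists_profile₁ hp hf₁ ht
    have hC := h _ self_mem_Ici
    rw [hs.Φ₁_y₁ t ht, hy₁ t ht.le, heatProfile_interface hp.α₁_pos hp.α₁_pos _ _ _ ht,
      div_self hp.α₁_pos.ne', sqrt_one, mul_one] at hC
    -- Phase 1 has only one interface; the second relation for `c` and `K` is the limit at infinity.
    have hD : c + K = p.D := by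
      refine tendsto_nhds_unique (tendsto_heatProfile_atTop c K hp.α₁_pos ht)
        ((hs.infinity t ht).congr' ?_)
      filter_upwards [eventually_ge_atTop (s.y₁ t)] with x hx using h x hx
    obtain rfl : K = p.amp₁ ξ₁ := by
      rw [Params.amp₁, eq_div_iff (erfc_pos ξ₁).ne', erfc]
      linarith
    rwa [← hD, add_sub_cancel_right]

end IsSolution

/-- The Stefan conditions fix the parameters of an explicit candidate. -/
lemma Same.equations {p : Params} (hp : p.Admissible) {s : Candidate} {ξ₁ ξ₂ : ℝ}
    (hs : IsSolution p s) (h₂ : 0 < ξ₂) (h₁ : ξ₂ < ξ₁) (h : Same s (explicit p ξ₁ ξ₂)) :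
    p.H ξ₁ = erf (ξ₂ * √(p.α₁ / p.α₂)) ∧ p.Q ξ₁ = p.T ξ₂ := by
  obtain ⟨hy, hΦ⟩ := h
  -- One instant suffices, because the Stefan conditions of an explicit candidate do not depend on
  -- time.
  obtain ⟨h3, h2, h1⟩ := hΦ 1 one_pos
  obtain ⟨y1, y2⟩ := hy 1 zero_le_one
  have hlt := hp.interface_lt h₁ one_pos
  have hpos := hp.interface_pos h₂ one_pos
  have hev : ∀ᶠ t : ℝ in 𝓝 1, 0 ≤ t := eventually_ge_nhds one_pos
  have d1 : deriv s.y₁ 1 = deriv (explicit p ξ₁ ξ₂).y₁ 1 :=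
    EventuallyEq.deriv_eq (hev.mono fun t ht => (hy t ht).1)
  have d2 : deriv s.y₂ 1 = deriv (explicit p ξ₁ ξ₂).y₂ 1 :=
    EventuallyEq.deriv_eq (hev.mono fun t ht => (hy t ht).2)
  have s1 := hs.stefan₁ 1 one_pos
  have s2 := hs.stefan₂ 1 one_pos
  rw [y1, y2, d1, derivWithin_congr h1 (h1 _ self_mem_Ici),
    derivWithin_congr h2 (h2 _ (right_mem_Icc.2 hlt.le))] at s1
  rw [y1, y2, d2, derivWithin_congr h2 (h2 _ (left_mem_Icc.2 hlt.le)),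
    derivWithin_congr h3 (h3 _ (right_mem_Icc.2 hpos.le))] at s2
  have hH := (hp.explicit_stefan₁_iff h₂ h₁ one_pos).1 s1
  exact ⟨hH, (hp.explicit_stefan₂_iff h₂ h₁ hH one_pos).1 s2⟩

end ThreePhaseStefan

/-! ### The main theorem. -/

theorem theorem2p1 (p : ThreePhaseStefan.Params) (hp : p.Admissible) (hα : p.α₃ < p.α₂) :
    ∃ z₀ : ℝ,
      -- `z₀ = H⁻¹(0)`
      (0 < z₀ ∧ p.H z₀ = 0 ∧ ∀ z, 0 ≤ z → p.H z = 0 → z = z₀) ∧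
      (p.h₂ z₀ < p.h₀ →
        ∃ ξ₁ ξ₂ : ℝ,
          -- `ξ₁` is the unique root of `Q = U` in `(z₀, ∞)`, and `ξ₂` is given by `ξ₁`
          (z₀ < ξ₁ ∧ p.Q ξ₁ = p.U ξ₁ ∧ ∀ z, z₀ < z → p.Q z = p.U z → z = ξ₁) ∧
          ξ₂ = √(p.α₂ / p.α₁) * ThreePhaseStefan.erfInv (p.H ξ₁) ∧
          ThreePhaseStefan.erf (ξ₂ * √(p.α₁ / p.α₂)) = p.H ξ₁ ∧
          0 < ξ₂ ∧ ξ₂ < ξ₁ ∧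
          -- existence
          ThreePhaseStefan.IsSolution p (ThreePhaseStefan.explicit p ξ₁ ξ₂) ∧
          ThreePhaseStefan.IsSimilarityType (ThreePhaseStefan.explicit p ξ₁ ξ₂) ∧
          -- uniqueness
          ∀ s : ThreePhaseStefan.Candidate, ThreePhaseStefan.IsSolution p s →
            ThreePhaseStefan.IsSimilarityType s →
            ThreePhaseStefan.Same s (ThreePhaseStefan.explicit p ξ₁ ξ₂)) := by
  obtain ⟨z₀, hz₀, hH, huniq⟩ := hp.exists_unique_zero_H
  refine ⟨z₀, ⟨hz₀, hH, huniq⟩, fun hh => ?_⟩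
  obtain ⟨ξ₁, hξ₁, hQ, hroot⟩ := hp.exists_unique_root hz₀ hH hα hh
  have hξ₁0 : 0 ≤ ξ₁ := (hz₀.trans hξ₁).le
  have hE := hp.erf_xi₂ hξ₁0 (hp.H_nonneg hz₀ hH hξ₁.le)
  have h₂ : 0 < p.xi₂ ξ₁ := by
    have := hp.xi₂_strictMonoOn hz₀ hH self_mem_Ici hξ₁.le hξ₁
    rwa [ThreePhaseStefan.Params.Admissible.xi₂_of_H_eq_zero hH] at this
  have h₁ : p.xi₂ ξ₁ < ξ₁ := by
    have := hp.H_lt_erf hξ₁0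
    rw [← hE, ThreePhaseStefan.erf_strictMono.lt_iff_lt] at this
    exact lt_of_mul_lt_mul_right this hp.sqrt_ratio_pos.le
  refine ⟨ξ₁, p.xi₂ ξ₁, ⟨hξ₁, hQ, hroot⟩, rfl, hE, h₂, h₁,
    hp.explicit_isSolution h₂ h₁ hE.symm hQ, hp.explicit_isSimilarityType h₂ h₁,
    fun s hs hsim => ?_⟩
  obtain ⟨η₁, η₂, hη₂, hη₁, hsame⟩ := hs.exists_same_explicit hp hsim
  obtain ⟨hHη, hQη⟩ := hsame.equations hp hs hη₂ hη₁
  -- With `η₂` replaced by `xi₂ η₁`, `hQη` is by definition `Q η₁ = U η₁`.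
  obtain rfl := hp.eq_xi₂ hHη
  -- The root is unique only beyond `z₀`; `η₂ > 0` makes `H η₁` positive, which places `η₁` there.
  have hz : z₀ < η₁ := by
    rw [← hp.H_strictMonoOn.lt_iff_lt hz₀.le (hη₂.trans hη₁).le, hH, hHη]
    exact ThreePhaseStefan.erf_pos (mul_pos hη₂ hp.sqrt_ratio_pos)
  obtain rfl := hroot η₁ hz hQη
  exact hsame
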